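/- Let $G=(V,E,\omega)$ be a finite connected simple weighted graph with $V=\{1,\dots,n\}$, where $E$ is regarded as a symmetric set of ordered pairs and $\omega=(\omega_{ij})$ is a symmetric $n\times n$ matrix with nonnegative entries such that $\omega_{ij}>0$ if $(i,j)\in E$. Let $N(i)=\{j : (i,j)\in E\}$ and $\mathcal P(G)=\{\rho\in[0,1]^n : \sum_i\rho_i=1\}$, and let $S^{n\times n}$ be the set of real skew-symmetric $n\times n$ matrices. Let $g:[0,\infty)^2\to[0,\infty)$ be continuous, of class $C^\infty$ on $(0,\infty)^2$, symmetric, positive on $(0,\infty)^2$, concave, and such that $g(lr,ls)=l\,g(r,s)$ for all $l,r,s>0$, and assume $$\int_0^1\frac{dr}{\sqrt{g(r,1-r)}}<\infty .$$ For $\phi\in\mathbb R^n$ set $(\nabla_G\phi)_{ij}=\sqrt{\omega_{ij}}\,(\phi_i-\phi_j)$ for $(i,j)\in E$. For $\rho\in\mathcal P(G)$ and $b,m\in S^{n\times n}$ set $$\|b\|_\rho^2=\frac12\sum_{(i,j)\in E}b_{ij}^2\,g(\rho_i,\rho_j),\qquad F(\rho,m)=\frac12\sum_{(i,j)\in E}f\bigl(g(\rho_i,\rho_j),m_{ij}\bigr),$$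 where $f(t,s)=s^2/t$ if $t>0$, $f(0,0)=0$, and $f(t,s)=\infty$ otherwise. For $a\in\mathbb R^n$ and $b\in S^{n\times n}$ set $$H(a,b)=\sup_{\rho\in\mathcal P(G)}\Bigl\{(a,\rho)+\frac12\|b\|_\rho^2\Bigr\},$$ where $(\cdot,\cdot)$ is the standard inner product of $\mathbb R^n$. Let $\rho^0,\rho^1\in\mathcal P(G)$. Let $\mathcal C(\rho^0,\rho^1)$ be the set of pairs $(\rho,m)$ such that $\rho:[0,1]\to\mathcal P(G)$, $m:(0,1)\to S^{n\times n}$, $\rho_i\in H^1(0,1)$ for all $i$, $m_{ij}\in L^2(0,1)$ for all $(i,j)\in E$, $\rho(0)=\rho^0$, $\rho(1)=\rho^1$, and $$\dot\rho_i+\sum_{j\in N(i)}\sqrt{\omega_{ij}}\,m_{ji}=0\quad\text{weakly on }(0,1)\text{ for every }i\in V.$$ Let $\mathcal A(\rho,m)=\frac12\int_0^1F(\rho,m)\,dt\in[0,\infty]$. Elements of $H^1(0,1)$ are identified with their continuous representatives on $[0,1]$. Then $\mathcal A$ attains its minimum over $\mathcal C(\rho^0,\rho^1)$, the minimum is finite,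 and $$\min_{(\rho,m)\in\mathcal C(\rho^0,\rho^1)}\mathcal A(\rho,m)=\sup\Bigl\{(\lambda(1),\rho^1)-(\lambda(0),\rho^0)\ :\ \lambda\in H^1(0,1;\mathbb R^n),\ H(\dot\lambda,\nabla_G\lambda)=0\text{ a.e. in }(0,1)\Bigr\}.$$ -/

import Mathlib

open Set MeasureTheory
open scoped ENNReal ContDiff

namespace GraphTransport

noncomputable section

/-- A connected weighted simple graph on the vertex set `V = Fin n`. The weights form a symmetric
matrix with nonnegative entries, which are positive on edges. -/
structure WeightedGraph (n : ℕ) where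
  graph : SimpleGraph (Fin n)
  connected : graph.Connected
  weight : Matrix (Fin n) (Fin n) ℝ
  weight_symm : weight.IsSymm
  weight_nonneg : ∀ i j, 0 ≤ weight i j
  weight_pos : ∀ i j, graph.Adj i j → 0 < weight i j

/-- The standing assumptions on the function `g : [0,∞)² → [0,∞)`; the values of `g` outside
`[0,∞)²` are irrelevant. -/
structure IsMobility (g : ℝ → ℝ → ℝ) : Prop where
  nonneg : ∀ r s, 0 ≤ r → 0 ≤ s → 0 ≤ g r s
  continuousOn : ContinuousOn (fun p : ℝ × ℝ => g p.1 p.2) (Ici 0 ×ˢ Ici 0)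
  contDiffOn : ContDiffOn ℝ ∞ (fun p : ℝ × ℝ => g p.1 p.2) (Ioi 0 ×ˢ Ioi 0)
  symm : ∀ r s, 0 ≤ r → 0 ≤ s → g r s = g s r
  pos : ∀ r s, 0 < r → 0 < s → 0 < g r s
  homogeneous : ∀ l r s, 0 < l → 0 < r → 0 < s → g (l * r) (l * s) = l * g r s
  concaveOn : ConcaveOn ℝ (Ici 0 ×ˢ Ici 0) (fun p : ℝ × ℝ => g p.1 p.2)

/-- The constant `C_g = ∫₀¹ dr / √(g(r, 1 - r))` in `[0,∞]`. -/
def energyConstant (g : ℝ → ℝ → ℝ) : ℝ≥0∞ :=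
  ∫⁻ r in Ioo (0 : ℝ) 1, ENNReal.ofReal (1 / √(g r (1 - r)))

/-! ### Functions on the time interval `(0,1)` -/

/-- `u ∈ L²(0,1)`. -/
def MemL2 (u : ℝ → ℝ) : Prop :=
  MemLp u 2 (volume.restrict (Ioo (0 : ℝ) 1))

/-- The locally integrable function `v` is the weak derivative of the locally integrable
function `u` on `(0,1)`. -/
def HasWeakDeriv (u v : ℝ → ℝ) : Prop :=
  LocallyIntegrableOn u (Ioo (0 : ℝ) 1) ∧ LocallyIntegrableOn v (Ioo (0 : ℝ) 1) ∧
    ∀ φ : ℝ → ℝ, ContDiff ℝ ∞ φ → HasCompactSupport φ → tsupport φ ⊆ Ioo (0 : ℝ) 1 →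
      ∫ t in Ioo (0 : ℝ) 1, u t * deriv φ t = - ∫ t in Ioo (0 : ℝ) 1, v t * φ t

/-- `u ∈ H¹(0,1)`, with weak derivative `v`. As usual an element of `H¹(0,1)` is identified with
its representative that is continuous on `[0,1]`, so that `u 0` and `u 1` are its boundary
values. -/
def HasH1Deriv (u v : ℝ → ℝ) : Prop :=
  ContinuousOn u (Icc 0 1) ∧ MemL2 u ∧ MemL2 v ∧ HasWeakDeriv u v

/-- `u ∈ H¹(0,1)`. -/
def MemH1 (u : ℝ → ℝ) : Prop := ∃ v, HasH1Deriv u v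

/-! ### Calculus on the graph -/

variable {n : ℕ}

open Classical in
/-- The edge set `E`, as a symmetric set of ordered pairs. -/
def WeightedGraph.edges (G : WeightedGraph n) : Finset (Fin n × Fin n) :=
  Finset.univ.filter fun e => G.graph.Adj e.1 e.2

open Classical in
/-- The neighbourhood `N(i)` of a vertex. -/
def WeightedGraph.nbr (G : WeightedGraph n) (i : Fin n) : Finset (Fin n) :=
  Finset.univ.filter fun j => G.graph.Adj i j

open Classical in
/-- The discrete gradient `(∇_G φ)_{ij} = √ω_{ij} (φ_i - φ_j)` for `(i,j) ∈ E`, extended by `0`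
to a skew-symmetric matrix. -/
def grad (G : WeightedGraph n) (φ : Fin n → ℝ) : Matrix (Fin n) (Fin n) ℝ :=
  fun i j => if G.graph.Adj i j then √(G.weight i j) * (φ i - φ j) else 0

/-- The divergence `(∇_G · m)_i = ∑_{j ∈ N(i)} √ω_{ij} m_{ji}`. -/
def divergence (G : WeightedGraph n) (m : Matrix (Fin n) (Fin n) ℝ) : Fin n → ℝ :=
  fun i => ∑ j ∈ G.nbr i, √(G.weight i j) * m j i

/-- The squared norm `‖b‖²_ρ = ½ ∑_{(i,j) ∈ E} b_{ij}² g(ρ_i, ρ_j)`. -/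
def normSq (G : WeightedGraph n) (g : ℝ → ℝ → ℝ) (ρ : Fin n → ℝ)
    (b : Matrix (Fin n) (Fin n) ℝ) : ℝ :=
  1 / 2 * ∑ e ∈ G.edges, b e.1 e.2 ^ 2 * g (ρ e.1) (ρ e.2)

/-- The Hamiltonian `H(a,b) = sup_{ρ ∈ 𝒫(G)} {(a,ρ) + ½ ‖b‖²_ρ}`. -/
def hamiltonian (G : WeightedGraph n) (g : ℝ → ℝ → ℝ) (a : Fin n → ℝ)
    (b : Matrix (Fin n) (Fin n) ℝ) : ℝ :=
  sSup ((fun ρ : Fin n → ℝ => ∑ i, a i * ρ i + 1 / 2 * normSq G g ρ b) '' stdSimplex ℝ (Fin n))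

/-- The function `f(t,s)`, equal to `s²/t` if `t > 0`, to `0` if `s = t = 0`, and to `∞`
otherwise. -/
def kinetic (t s : ℝ) : ℝ≥0∞ :=
  if 0 < t then ENNReal.ofReal (s ^ 2 / t) else if s = 0 ∧ t = 0 then 0 else ∞

/-- `F(ρ,m) = ½ ∑_{(i,j) ∈ E} f(g(ρ_i, ρ_j), m_{ij})`. -/
def kineticEnergy (G : WeightedGraph n) (g : ℝ → ℝ → ℝ) (ρ : Fin n → ℝ)
    (m : Matrix (Fin n) (Fin n) ℝ) : ℝ≥0∞ :=
  1 / 2 * ∑ e ∈ G.edges, kinetic (g (ρ e.1) (ρ e.2)) (m e.1 e.2)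

/-- The action `𝒜(ρ,m) = ½ ∫₀¹ F(ρ,m) dt`. -/
def action (G : WeightedGraph n) (g : ℝ → ℝ → ℝ) (ρ : ℝ → Fin n → ℝ)
    (m : ℝ → Matrix (Fin n) (Fin n) ℝ) : ℝ≥0∞ :=
  1 / 2 * ∫⁻ t in Ioo (0 : ℝ) 1, kineticEnergy G g (ρ t) (m t)

/-- The set `𝒞(ρ⁰,ρ¹)` of pairs `(ρ,m)` with `ρ : [0,1] → 𝒫(G)` of class `H¹`, with `m` a
square-integrable field of skew-symmetric matrices, with endpoints `ρ⁰` and `ρ¹`, and with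
`ρ̇ + ∇_G · m = 0` weakly on `(0,1)`. -/
def admissible (G : WeightedGraph n) (ρ0 ρ1 : Fin n → ℝ) :
    Set ((ℝ → Fin n → ℝ) × (ℝ → Matrix (Fin n) (Fin n) ℝ)) :=
  {p | (∀ t ∈ Icc (0 : ℝ) 1, p.1 t ∈ stdSimplex ℝ (Fin n)) ∧
    (∀ i, MemH1 fun t => p.1 t i) ∧
    (∀ᵐ t ∂volume.restrict (Ioo (0 : ℝ) 1), (p.2 t).transpose = -p.2 t) ∧
    (∀ i j, G.graph.Adj i j → MemL2 fun t => p.2 t i j) ∧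
    p.1 0 = ρ0 ∧ p.1 1 = ρ1 ∧
    ∀ i, HasWeakDeriv (fun t => p.1 t i) fun t => -divergence G (p.2 t) i}

/-- The values `(λ(1),ρ¹) - (λ(0),ρ⁰)`, where `λ ∈ H¹(0,1;ℝⁿ)` satisfies the Hamilton-Jacobi
equation `H(λ̇, ∇_G λ) = 0` almost everywhere on `(0,1)`. -/
def dualValues (G : WeightedGraph n) (g : ℝ → ℝ → ℝ) (ρ0 ρ1 : Fin n → ℝ) : Set ℝ :=
  {x | ∃ l l' : ℝ → Fin n → ℝ,
    (∀ i, HasH1Deriv (fun t => l t i) fun t => l' t i) ∧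
    (∀ᵐ t ∂volume.restrict (Ioo (0 : ℝ) 1), hamiltonian G g (l' t) (grad G (l t)) = 0) ∧
    x = ∑ i, l 1 i * ρ1 i - ∑ i, l 0 i * ρ0 i}

end

end GraphTransport

/-! Weak duality is an integration by parts. Pairing the continuity equation with `λ` turns the
boundary values into `∫ (λ̇,ρ) + ½ ∑ m · ∇λ` (up to the factor counting orientations); the
Hamilton-Jacobi equation bounds `(λ̇,ρ)` by `-½ ‖∇λ‖²_ρ`, and Young's inequality on each edge leaves
the action (`dualValue_le_action`).

The supremum is finite because subsolutions satisfy `λ_j(t) - λ_i(s) ≤ C / (t - s)`: the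
Hamilton-Jacobi inequality is tested with mass moving along an edge from `i` to `j`
(`IsSubsolution.le_of_adj`), and edges are chained along a walk.

The converse inequality and the existence of a minimizer come together from a minimax argument. Let
`D` be the supremum and `B(l)` the boundary term. Subtracting `∫₀ᵗ H(l̇,∇l)` from every component of
a C¹ curve `l` gives a solution of the Hamilton-Jacobi equation, since gradients ignore constants;
hence `B(l) - ∫ H(l̇,∇l) ≤ D` for all such `l`. With `H` written as a supremum over the simplex, a
measurable selection shows that for each `l` some L² curve `x` in the simplex almost realizes this
inequality. These curves form a bounded closed convex set in a Hilbert space, and the integrand is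
concave in `x` and convex in `l`, so a single `x` serves all `l`
(`IsMobility.exists_optimal_curve`): `B(l) - ∫ (l̇,x) ≤ D + ½ ∫ ‖∇l‖²_x`. The left side is linear
and the right side quadratic in `l`, so the left side is an inner product `⟨w, √g ∇l⟩` (suitably
normalized) with `½ ‖w‖² ≤ D` (`exists_inner_eq_of_le_quadratic`). This identity is the weak
continuity equation with its boundary conditions: `w` determines the momentum, the continuous
representative of `x` is the density, and the action is at most `D`
(`IsMobility.exists_admissible_action_le`). -/

namespace GraphTransport

/-! ### Convexity in Hilbert space: intersections, minimax, representation of functionals. -/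

section Hilbert

variable {E : Type*} [NormedAddCommGroup E] [InnerProductSpace ℝ E]

/-- The midpoint of `x` and `y` lies in `C`, so its norm is at least `‖x‖`; the parallelogram law
does the rest. -/
theorem norm_sub_sq_le_of_convex {C : Set E} (hC : Convex ℝ C) {x y : E} (hx : x ∈ C)
    (hy : y ∈ C) (hmin : ∀ z ∈ C, ‖x‖ ≤ ‖z‖) : ‖x - y‖ ^ 2 ≤ 2 * (‖y‖ ^ 2 - ‖x‖ ^ 2) := by
  have hz : (1 / 2 : ℝ) • x + (1 / 2 : ℝ) • y ∈ C :=
    hC hx hy (by norm_num) (by norm_num) (by norm_num)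
  have h1 := hmin _ hz
  rw [← smul_add, norm_smul] at h1
  have h2 := parallelogram_law_with_norm ℝ x y
  norm_num at h1
  nlinarith [norm_nonneg x, norm_nonneg y, norm_nonneg (x + y), norm_nonneg (x - y)]

/-- In a Hilbert space a directed family of nonempty bounded closed convex sets has a common
point. -/
theorem nonempty_iInter_of_directed_of_convex [CompleteSpace E] {ι : Type*} [Nonempty ι]
    {C : ι → Set E} (hd : Directed (· ⊇ ·) C) (hcl : ∀ i, IsClosed (C i))
    (hcv : ∀ i, Convex ℝ (C i)) (hne : ∀ i, (C i).Nonempty) {R : ℝ}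
    (hR : ∀ i, ∀ x ∈ C i, ‖x‖ ≤ R) : (⋂ i, C i).Nonempty := by
  have hmin : ∀ i, ∃ x ∈ C i, ∀ z ∈ C i, ‖x‖ ≤ ‖z‖ := fun i => by
    obtain ⟨v, hv, h⟩ := exists_norm_eq_iInf_of_complete_convex (hne i) (hcl i).isComplete
      (hcv i) 0
    refine ⟨v, hv, fun z hz => ?_⟩
    have : ‖(0 : E) - v‖ ≤ ‖(0 : E) - z‖ := by
      rw [h]
      exact ciInf_le ⟨0, by rintro _ ⟨w, rfl⟩; exact norm_nonneg _⟩ (⟨z, hz⟩ : C i)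
    simpa using this
  choose x hx hxm using hmin
  have hbdd : BddAbove (range fun i => ‖x i‖ ^ 2) :=
    ⟨R ^ 2, by
      rintro _ ⟨i, rfl⟩
      exact pow_le_pow_left₀ (norm_nonneg _) (hR i _ (hx i)) 2⟩
  set s := ⨆ i, ‖x i‖ ^ 2 with hs
  -- Minimal norms grow as the sets shrink. Once `‖x (i k)‖²` is within `1/(k+1)` of the supremum,
  -- passing to any smaller set moves the minimal point by at most `√(2/(k+1))`.
  have hk : ∀ k : ℕ, ∃ i, s - 1 / ((k : ℝ) + 1) < ‖x i‖ ^ 2 := fun k =>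
    exists_lt_of_lt_ciSup (by have : (0 : ℝ) < 1 / ((k : ℝ) + 1) := by positivity
                              linarith)
  choose i hi using hk
  have key : ∀ k j, C j ⊆ C (i k) → ‖x (i k) - x j‖ ≤ √(2 * (1 / ((k : ℝ) + 1))) := by
    intro k j hj
    apply Real.le_sqrt_of_sq_le
    have h1 := norm_sub_sq_le_of_convex (hcv (i k)) (hx (i k)) (hj (hx j)) (hxm (i k))
    have h2 : ‖x j‖ ^ 2 ≤ s := le_ciSup hbdd j
    have := hi k
    linarith
  have hlim : Filter.Tendsto (fun k : ℕ => √(2 * (1 / ((k : ℝ) + 1)))) Filter.atTop (nhds 0) := by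
    have := (Real.continuous_sqrt.tendsto _).comp
      ((tendsto_one_div_add_atTop_nhds_zero_nat (𝕜 := ℝ)).const_mul 2)
    rwa [mul_zero, Real.sqrt_zero] at this
  have hcau : CauchySeq fun k => x (i k) := by
    rw [Metric.cauchySeq_iff']
    intro ε hε
    have hev := (Metric.tendsto_atTop.1 hlim) (ε / 2) (by positivity)
    obtain ⟨N, hN⟩ := hev
    refine ⟨N, fun k hkN => ?_⟩
    -- The sets `C (i k)` need not be nested; two of them are compared through a common smaller set.
    obtain ⟨m, h1, h2⟩ := hd (i k) (i N)
    have a1 := key k m h1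
    have a2 := key N m h2
    have b1 := hN k hkN
    have b2 := hN N le_rfl
    rw [Real.dist_0_eq_abs, abs_of_nonneg (Real.sqrt_nonneg _)] at b1 b2
    calc dist (x (i k)) (x (i N)) ≤ dist (x (i k)) (x m) + dist (x (i N)) (x m) :=
          dist_triangle_right _ _ _
      _ < ε := by rw [dist_eq_norm, dist_eq_norm]; linarith
  obtain ⟨y, hy⟩ := cauchySeq_tendsto_of_complete hcau
  refine ⟨y, mem_iInter.2 fun j => ?_⟩
  have hj : ∀ k, ∃ m, C m ⊆ C (i k) ∧ C m ⊆ C j := fun k => by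
    obtain ⟨m, h1, h2⟩ := hd (i k) j
    exact ⟨m, h1, h2⟩
  choose m hm1 hm2 using hj
  have hdiff : Filter.Tendsto (fun k => x (i k) - x (m k)) Filter.atTop (nhds 0) :=
    squeeze_zero_norm (fun k => key k (m k) (hm1 k)) hlim
  have hy' : Filter.Tendsto (fun k => x (m k)) Filter.atTop (nhds y) := by
    simpa using hy.sub hdiff
  exact (hcl j).mem_of_tendsto hy' (Filter.Eventually.of_forall fun k => hm2 k (hx (m k)))

/-- The finite case of the minimax inequality. -/
theorem exists_forall_lt_of_finite {F V : Type*} [AddCommGroup F] [Module ℝ F]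
    [AddCommGroup V] [Module ℝ V]
    {K : Set F} (hKn : K.Nonempty) {L : F → V → ℝ}
    (hconv : ∀ l, ConvexOn ℝ K fun x => L x l) (hconc : ∀ x ∈ K, ConcaveOn ℝ univ (L x))
    {D : ℝ} (hD : ∀ l, ∃ x ∈ K, L x l < D) (s : Finset V) :
    ∃ x ∈ K, ∀ l ∈ s, L x l < D := by
  classical
  -- The set of vectors strictly above some value vector `(L x l)_l` is convex and open. If the
  -- constant vector `D` lay outside, a separating functional would supply weights `p` for a convex
  -- combination of parameters that contradicts `hD`.
  set S : Set (s → ℝ) := {y | ∃ x ∈ K, ∀ l : s, L x l < y l} with hS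
  have hSo : IsOpen S := by
    have : S = ⋃ x ∈ K, ⋂ l : s, {y : s → ℝ | L x l < y l} := by
      ext y; simp [hS]
    rw [this]
    exact isOpen_biUnion fun x _ => isOpen_iInter_of_finite fun l =>
      isOpen_lt continuous_const (continuous_apply l)
  have hSc : Convex ℝ S := by
    rintro y ⟨x, hx, hxy⟩ y' ⟨x', hx', hxy'⟩ a b ha hb hab
    -- Convexity of `K` is read off from the parameter `0`, because `s` may be empty.
    refine ⟨a • x + b • x', (hconv 0).1 hx hx' ha hb hab, fun l => ?_⟩
    have h1 := (hconv l).2 hx hx' ha hb hab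
    have h2 := hxy l
    have h3 := hxy' l
    simp only [smul_eq_mul, Pi.add_apply, Pi.smul_apply] at h1 ⊢
    refine h1.trans_lt ?_
    rcases ha.eq_or_lt with rfl | ha'
    · have : b = 1 := by linarith
      subst this; linarith
    · have := mul_lt_mul_of_pos_left h2 ha'
      have := mul_le_mul_of_nonneg_left h3.le hb
      linarith
  by_contra hcon
  push Not at hcon
  have hd : (fun _ => D : s → ℝ) ∉ S := by
    rintro ⟨x, hx, h⟩
    obtain ⟨l, hl, h'⟩ := hcon x hx
    exact absurd (h ⟨l, hl⟩) (not_lt.2 h')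
  obtain ⟨f, hf⟩ := geometric_hahn_banach_open_point hSc hSo hd
  obtain ⟨x0, hx0⟩ := hKn
  set p : s → ℝ := fun l => -f (Pi.single l 1) with hp
  have hfp : ∀ y : s → ℝ, f y = -∑ l, p l * y l := by
    intro y
    conv_lhs => rw [pi_eq_sum_univ' y]
    simp [hp, map_sum, mul_comm]
  have hfd : f (fun _ => D) = -((∑ l, p l) * D) := by rw [hfp, Finset.sum_mul]
  have hmem : ∀ x ∈ K, ∀ y : s → ℝ, (∀ l : s, L x l < y l) → (∑ l, p l) * D < ∑ l, p l * y l := by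
    intro x hx y hy
    have := hf y ⟨x, hx, hy⟩
    rw [hfd, hfp] at this
    linarith
  have hpn : ∀ l, 0 ≤ p l := by
    intro l
    by_contra! hneg
    -- A negative weight is impossible: raising coordinate `l` by `c / -p l` stays in `S` but uses
    -- up the whole gap `c`.
    set c := ∑ k, p k * (L x0 k + 1) - (∑ k, p k) * D with hc
    have hc0 : 0 < c := sub_pos.2 (hmem x0 hx0 _ fun k => by linarith)
    have h := hmem x0 hx0 (fun k => L x0 k + 1 + Pi.single (M := fun _ => ℝ) l (c / -p l) k)
      fun k => by
        have : 0 ≤ Pi.single (M := fun _ => ℝ) l (c / -p l) k := by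
          have : 0 ≤ c / -p l := div_nonneg hc0.le (by linarith)
          by_cases hkl : k = l
          · subst hkl; simpa using this
          · simp [hkl]
        linarith
    simp only [mul_add (p _) (L x0 _ + 1), Finset.sum_add_distrib] at h
    have h2 : ∑ k, p k * Pi.single (M := fun _ => ℝ) l (c / -p l) k = -c := by
      rw [Finset.sum_eq_single l (fun k _ hk => by simp [hk]) (by simp)]
      rw [Pi.single_eq_same, div_neg, mul_neg, mul_div_cancel₀ _ hneg.ne]
    rw [h2] at h
    linarith
  have hpos : 0 < ∑ l, p l := by
    refine (Finset.sum_nonneg fun l _ => hpn l).lt_of_ne fun h0 => ?_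
    have hz : ∀ l, p l = 0 := fun l =>
      (Finset.sum_eq_zero_iff_of_nonneg fun l _ => hpn l).1 h0.symm l (Finset.mem_univ l)
    have := hmem x0 hx0 (fun k => L x0 k + 1) fun k => by linarith
    simp [hz] at this
  set P := ∑ l, p l with hP
  obtain ⟨x, hx, hlt⟩ := hD (∑ l : s, (p l / P) • (l : V))
  have h1 := (hconc x hx).le_map_sum (t := Finset.univ) (w := fun l : s => p l / P)
    (p := fun l : s => (l : V)) (fun l _ => div_nonneg (hpn l) hpos.le)
    (by rw [← Finset.sum_div, ← hP, div_self hpos.ne']) (fun _ _ => mem_univ _)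
  have h2 : ∑ l : s, p l * L x l < P * D := by
    have h3 := mul_lt_mul_of_pos_left (h1.trans_lt hlt) hpos
    simp only [smul_eq_mul, Finset.mul_sum] at h3
    refine lt_of_eq_of_lt (Finset.sum_congr rfl fun l _ => ?_) h3
    field_simp
  -- The slack `δ` is spread equally over all coordinates, so that the weighted sum becomes exactly
  -- `P * D`, against the strict separation.
  set δ := (P * D - ∑ l : s, p l * L x l) / P with hδ
  have hδ0 : 0 < δ := div_pos (by linarith) hpos
  have h4 := hmem x hx (fun l => L x l + δ) fun l => by linarith
  simp only [mul_add, Finset.sum_add_distrib, ← Finset.sum_mul] at h4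
  rw [← hP, hδ, mul_div_cancel₀ _ hpos.ne'] at h4
  linarith

/-- A minimax theorem: for a function that is convex with closed sublevel sets in a point of a
bounded closed convex subset of a Hilbert space, and concave in a parameter. -/
theorem exists_forall_le_of_minimax [CompleteSpace E] {V : Type*} [AddCommGroup V] [Module ℝ V]
    {K : Set E} {R : ℝ} (hKn : K.Nonempty) (hR : ∀ x ∈ K, ‖x‖ ≤ R) {L : E → V → ℝ}
    (hconv : ∀ l, ConvexOn ℝ K fun x => L x l)
    (hclosed : ∀ l c, IsClosed {x | x ∈ K ∧ L x l ≤ c})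
    (hconc : ∀ x ∈ K, ConcaveOn ℝ univ (L x))
    {D : ℝ} (hD : ∀ l, ∀ ε > 0, ∃ x ∈ K, L x l ≤ D + ε) :
    ∃ x ∈ K, ∀ l, L x l ≤ D := by
  classical
  -- Including the parameter `0` makes each set an intersection over a nonempty family, hence
  -- closed; closedness of `K` itself is not assumed.
  let C : Finset V × ℕ → Set E := fun q =>
    {x | x ∈ K ∧ ∀ l ∈ insert 0 q.1, L x l ≤ D + 1 / ((q.2 : ℝ) + 1)}
  have hCeq : ∀ q, C q = ⋂ l ∈ insert 0 q.1, {x | x ∈ K ∧ L x l ≤ D + 1 / ((q.2 : ℝ) + 1)} := by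
    intro q
    ext x
    simp only [C, mem_ofPred_eq, mem_iInter]
    exact ⟨fun h l hl => ⟨h.1, h.2 l hl⟩,
      fun h => ⟨(h 0 (Finset.mem_insert_self _ _)).1, fun l hl => (h l hl).2⟩⟩
  have hne : (⋂ q, C q).Nonempty := by
    refine nonempty_iInter_of_directed_of_convex (R := R) ?_ ?_ ?_ ?_ fun q x hx => hR x hx.1
    · rintro ⟨s, a⟩ ⟨t, b⟩
      refine ⟨(s ∪ t, max a b), ?_, ?_⟩
      · rintro x ⟨hx, h⟩
        refine ⟨hx, fun l hl => (h l ?_).trans ?_⟩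
        · simp only [Finset.mem_insert, Finset.mem_union] at hl ⊢
          tauto
        · gcongr
          exact le_max_left _ _
      · rintro x ⟨hx, h⟩
        refine ⟨hx, fun l hl => (h l ?_).trans ?_⟩
        · simp only [Finset.mem_insert, Finset.mem_union] at hl ⊢
          tauto
        · gcongr
          exact le_max_right _ _
    · intro q
      rw [hCeq]
      exact isClosed_biInter fun l _ => hclosed l _
    · intro q
      rw [hCeq]
      exact convex_iInter₂ fun l _ => (hconv l).convex_le _
    · intro q
      have hq : (0 : ℝ) < 1 / ((q.2 : ℝ) + 1) := by positivity
      obtain ⟨x, hx, h⟩ := exists_forall_lt_of_finite hKn hconv hconc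
        (D := D + 1 / ((q.2 : ℝ) + 1)) (fun l => by
          obtain ⟨x, hx, h⟩ := hD l (1 / ((q.2 : ℝ) + 1) / 2) (by positivity)
          exact ⟨x, hx, by linarith⟩) (insert 0 q.1)
      exact ⟨x, hx, fun l hl => (h l hl).le⟩
  obtain ⟨x, hx⟩ := hne
  rw [mem_iInter] at hx
  refine ⟨x, (hx (∅, 0)).1, fun l => ?_⟩
  have hlim : Filter.Tendsto (fun k : ℕ => D + 1 / ((k : ℝ) + 1)) Filter.atTop (nhds (D + 0)) :=
    (tendsto_one_div_add_atTop_nhds_zero_nat (𝕜 := ℝ)).const_add D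
  rw [add_zero] at hlim
  exact ge_of_tendsto' hlim fun k => (hx ({l}, k)).2 l (by simp)

/-- A linear functional dominated by a quadratic form `‖T l‖² / 2`, up to a constant, is
represented by a vector. -/
theorem exists_inner_eq_of_le_quadratic [CompleteSpace E] {V : Type*} [AddCommGroup V] [Module ℝ V]
    (T : V →ₗ[ℝ] E) (f : V →ₗ[ℝ] ℝ) {D : ℝ} (hf : ∀ l, f l ≤ D + 1 / 2 * ‖T l‖ ^ 2) :
    ∃ w : E, (∀ l, f l = inner ℝ w (T l)) ∧ 1 / 2 * ‖w‖ ^ 2 ≤ D := by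
  have hD : 0 ≤ D := by simpa using hf 0
  have hle : ∀ l, f l ≤ √(2 * D) * ‖T l‖ := by
    intro l
    by_contra! hlt
    have hfl : 0 < f l := lt_of_le_of_lt (by positivity) hlt
    -- Replacing `l` by `c • l` gives a nonnegative quadratic polynomial in `c`; its discriminant
    -- yields `f(l)² ≤ 2D ‖T l‖²`.
    have hq : ∀ c : ℝ, 0 ≤ 1 / 2 * ‖T l‖ ^ 2 * (c * c) + (-f l) * c + D := by
      intro c
      have := hf (c • l)
      rw [map_smul, map_smul, norm_smul, mul_pow, Real.norm_eq_abs, sq_abs, smul_eq_mul] at this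
      linarith
    have h := discrim_le_zero hq
    rw [discrim] at h
    have h2 : (√(2 * D) * ‖T l‖) ^ 2 < f l ^ 2 := by gcongr
    rw [mul_pow, Real.sq_sqrt (by positivity)] at h2
    linarith
  have habs : ∀ l, |f l| ≤ √(2 * D) * ‖T l‖ := fun l =>
    abs_le.2 ⟨by have := hle (-l); simp only [map_neg, norm_neg] at this; linarith, hle l⟩
  -- The bound makes `f` vanish on `ker T`, so it factors through the range of `T`; Hahn-Banach and
  -- Riesz then give the vector `w`.
  have hker : f ∈ LinearMap.range T.dualMap := by
    rw [LinearMap.range_dualMap_eq_dualAnnihilator_ker, Submodule.mem_dualAnnihilator]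
    intro l hl
    have := habs l
    rw [LinearMap.mem_ker.1 hl, norm_zero, mul_zero] at this
    exact abs_nonpos_iff.1 this
  obtain ⟨φ, hφ⟩ := hker
  have hφl : ∀ l, φ (T l) = f l := fun l => by rw [← hφ]; rfl
  let φr : StrongDual ℝ (LinearMap.range T) :=
    (φ.domRestrict (LinearMap.range T)).mkContinuous (√(2 * D)) (by
      rintro ⟨_, l, rfl⟩
      simpa [hφl] using habs l)
  obtain ⟨ψ, hψ, hψn⟩ := _root_.exists_extension_norm_eq (LinearMap.range T) φr
  refine ⟨(InnerProductSpace.toDual ℝ E).symm ψ, fun l => ?_, ?_⟩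
  · rw [InnerProductSpace.toDual_symm_apply, ← hφl]
    exact (hψ ⟨T l, LinearMap.mem_range_self T l⟩).symm
  · rw [LinearIsometryEquiv.norm_map, hψn]
    have h1 : ‖φr‖ ≤ √(2 * D) := LinearMap.mkContinuous_norm_le _ (Real.sqrt_nonneg _) _
    have h2 : ‖φr‖ ^ 2 ≤ √(2 * D) ^ 2 := by gcongr
    rw [Real.sq_sqrt (by positivity)] at h2
    linarith

end Hilbert

/-! ### One-dimensional Sobolev calculus on the unit interval. -/

section Calculus

theorem setIntegral_Ioo_eq_intervalIntegral (f : ℝ → ℝ) :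
    ∫ t in Ioo (0 : ℝ) 1, f t = ∫ t in (0 : ℝ)..1, f t := by
  rw [intervalIntegral.integral_of_le zero_le_one, integral_Ioc_eq_integral_Ioo]

theorem MemL2.intervalIntegrable {v : ℝ → ℝ} (hv : MemL2 v) {a b : ℝ} (ha : a ∈ Icc (0 : ℝ) 1)
    (hb : b ∈ Icc (0 : ℝ) 1) : IntervalIntegrable v volume a b := by
  have h : IntervalIntegrable v volume 0 1 :=
    (intervalIntegrable_iff_integrableOn_Ioo_of_le zero_le_one).2 (MemLp.integrable one_le_two hv)
  refine h.mono_set ?_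
  rw [uIcc_of_le zero_le_one]
  exact uIcc_subset_Icc ha hb

/-- Integration by parts for two primitives of integrable functions. -/
theorem integral_mul_add_mul_of_primitive {u v u' v' : ℝ → ℝ} {a b : ℝ} (hab : a ≤ b)
    (hu' : IntervalIntegrable u' volume a b) (hv' : IntervalIntegrable v' volume a b)
    (hu : ∀ t ∈ Icc a b, u t = u a + ∫ x in a..t, u' x)
    (hv : ∀ t ∈ Icc a b, v t = v a + ∫ x in a..t, v' x) :
    ∫ t in a..b, (u' t * v t + u t * v' t) = u b * v b - u a * v a := by
  have hc : ∀ c : ℝ, AbsolutelyContinuousOnInterval (fun _ => c) a b := fun c =>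
    (contDiff_const.contDiffOn).absolutelyContinuousOnInterval
  have hac : ∀ {f : ℝ → ℝ} (c : ℝ), IntervalIntegrable f volume a b →
      AbsolutelyContinuousOnInterval (fun t => c + ∫ x in a..t, f x) a b := fun c hf =>
    (hc c).fun_add (hf.absolutelyContinuousOnInterval_intervalIntegral (by simp))
  have h := (hac (u a) hu').integral_deriv_mul_eq_sub (hac (v a) hv')
  rw [← hu b (right_mem_Icc.2 hab), ← hv b (right_mem_Icc.2 hab)] at h
  simp only [intervalIntegral.integral_same, add_zero] at h
  rw [← h]
  refine intervalIntegral.integral_congr_ae ?_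
  filter_upwards [hu'.ae_hasDerivAt_integral, hv'.ae_hasDerivAt_integral] with t h1 h2 ht
  have ht' : t ∈ uIcc a b := uIoc_subset_uIcc ht
  rw [((h1 ht' a (by simp)).const_add _).deriv, ((h2 ht' a (by simp)).const_add _).deriv,
    ← hu t (by rwa [uIcc_of_le hab] at ht'), ← hv t (by rwa [uIcc_of_le hab] at ht')]

theorem eq_add_integral_deriv_of_contDiff {φ : ℝ → ℝ} (hφ : ContDiff ℝ 1 φ) (a t : ℝ) :
    φ t = φ a + ∫ x in a..t, deriv φ x := by
  rw [intervalIntegral.integral_deriv_eq_sub (fun x _ => hφ.differentiable one_ne_zero x)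
    ((hφ.continuous_deriv le_rfl).intervalIntegrable _ _)]
  ring

theorem eq_zero_of_tsupport_subset_Ioo {φ : ℝ → ℝ} {a b t : ℝ} (h : tsupport φ ⊆ Ioo a b)
    (ht : t ∉ Ioo a b) : φ t = 0 :=
  image_eq_zero_of_notMem_tsupport fun h' => ht (h h')

/-- A primitive of an `L²` function is an `H¹` function. -/
theorem hasH1Deriv_of_primitive {u v : ℝ → ℝ} (hv : MemL2 v)
    (hu : ∀ t ∈ Icc (0 : ℝ) 1, u t = u 0 + ∫ x in (0 : ℝ)..t, v x) : HasH1Deriv u v := by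
  have h0 : (0 : ℝ) ∈ Icc (0 : ℝ) 1 := ⟨le_rfl, zero_le_one⟩
  have h1 : (1 : ℝ) ∈ Icc (0 : ℝ) 1 := ⟨zero_le_one, le_rfl⟩
  have hvi := hv.intervalIntegrable h0 h1
  have hcont : ContinuousOn u (Icc 0 1) := by
    have := intervalIntegral.continuousOn_primitive_interval (μ := volume) (f := v) (a := 0) (b := 1)
      (by
        rw [uIcc_of_le zero_le_one, integrableOn_Icc_iff_integrableOn_Ioo]
        exact MemLp.integrable one_le_two hv)
    rw [uIcc_of_le zero_le_one] at this
    exact (continuousOn_const.add this).congr hu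
  have hm : MemL2 u := by
    obtain ⟨C, hC⟩ := isCompact_Icc.exists_bound_of_continuousOn hcont
    refine MemLp.of_bound (C := C)
      ((hcont.mono Ioo_subset_Icc_self).aestronglyMeasurable measurableSet_Ioo) ?_
    exact (ae_restrict_iff' measurableSet_Ioo).2
      (Filter.Eventually.of_forall fun t ht => hC t (Ioo_subset_Icc_self ht))
  refine ⟨hcont, hm, hv, IntegrableOn.locallyIntegrableOn (MemLp.integrable one_le_two hm),
    IntegrableOn.locallyIntegrableOn (MemLp.integrable one_le_two hv),
    fun φ hφ hc hs => ?_⟩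
  have hφ1 : ContDiff ℝ 1 φ := hφ.of_le (by exact_mod_cast le_top)
  have hd : IntervalIntegrable (deriv φ) volume 0 1 :=
    (hφ1.continuous_deriv le_rfl).intervalIntegrable _ _
  have hp := integral_mul_add_mul_of_primitive zero_le_one hvi hd hu
    fun t _ => eq_add_integral_deriv_of_contDiff hφ1 0 t
  rw [eq_zero_of_tsupport_subset_Ioo hs (t := 0) (by simp),
    eq_zero_of_tsupport_subset_Ioo hs (t := 1) (by simp),
    intervalIntegral.integral_add (hvi.mul_continuousOn hφ1.continuous.continuousOn)
      (hd.continuousOn_mul (by rwa [uIcc_of_le zero_le_one]))] at hp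
  rw [setIntegral_Ioo_eq_intervalIntegral, setIntegral_Ioo_eq_intervalIntegral]
  linarith

/-- Every smooth function with compact support in an open interval and integral zero has a
primitive of the same kind. -/
theorem exists_primitive_of_integral_eq_zero {ψ : ℝ → ℝ} (hψ : ContDiff ℝ ∞ ψ)
    (hc : HasCompactSupport ψ) (hs : tsupport ψ ⊆ Ioo (0 : ℝ) 1)
    (hi : ∫ t in (0 : ℝ)..1, ψ t = 0) :
    ∃ φ : ℝ → ℝ, ContDiff ℝ ∞ φ ∧ HasCompactSupport φ ∧ tsupport φ ⊆ Ioo (0 : ℝ) 1 ∧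
      deriv φ = ψ := by
  by_cases hne : (tsupport ψ).Nonempty
  swap
  · have h0 : ψ = 0 := tsupport_eq_empty_iff.1 (not_nonempty_iff_eq_empty.1 hne)
    subst h0
    exact ⟨0, contDiff_const, HasCompactSupport.zero, by simp, by ext; simp⟩
  have hK : IsCompact (tsupport ψ) := hc
  have ha := hs (hK.sInf_mem hne)
  have hb := hs (hK.sSup_mem hne)
  set a := sInf (tsupport ψ)
  set b := sSup (tsupport ψ)
  have hout : ∀ t, t ∉ Icc a b → ψ t = 0 := fun t ht =>
    image_eq_zero_of_notMem_tsupport fun h' =>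
      ht ⟨csInf_le hK.bddBelow h', le_csSup hK.bddAbove h'⟩
  have hder : ∀ t, HasDerivAt (fun t => ∫ x in (0 : ℝ)..t, ψ x) (ψ t) t := fun t =>
    intervalIntegral.integral_hasDerivAt_right (hψ.continuous.intervalIntegrable _ _)
      hψ.continuous.stronglyMeasurable.stronglyMeasurableAtFilter hψ.continuous.continuousAt
  have hd : deriv (fun t => ∫ x in (0 : ℝ)..t, ψ x) = ψ := funext fun t => (hder t).deriv
  have hsup : Function.support (fun t => ∫ x in (0 : ℝ)..t, ψ x) ⊆ Icc a b := by
    intro t ht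
    by_contra hnt
    refine ht ?_
    rcases lt_or_ge t a with h | h
    · refine (intervalIntegral.integral_congr (g := fun _ => (0 : ℝ)) fun x hx => ?_).trans (by simp)
      refine hout x fun hx' => ?_
      have : x ≤ max 0 t := hx.2
      exact absurd (hx'.1.trans this) (not_le.2 (max_lt ha.1 h))
    · have hbt : b < t := by
        by_contra h'
        exact hnt ⟨h, not_lt.1 h'⟩
      have hadd := intervalIntegral.integral_add_adjacent_intervals
        (hψ.continuous.intervalIntegrable (μ := volume) 0 t)
        (hψ.continuous.intervalIntegrable t 1)
      -- To the right of the support, the primitive equals the total integral, which is zero.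
      have h0 : ∫ x in t..1, ψ x = 0 := by
        refine (intervalIntegral.integral_congr (g := fun _ => (0 : ℝ)) fun x hx => ?_).trans
          (by simp)
        refine hout x fun hx' => ?_
        have : min t 1 ≤ x := hx.1
        exact absurd (this.trans hx'.2) (not_le.2 (lt_min hbt hb.2))
      rw [hi, h0, add_zero] at hadd
      exact hadd
  have hts : tsupport (fun t => ∫ x in (0 : ℝ)..t, ψ x) ⊆ Icc a b :=
    closure_minimal hsup isClosed_Icc
  refine ⟨_, ?_, HasCompactSupport.of_support_subset_isCompact isCompact_Icc hsup,
    hts.trans fun t ht => ⟨ha.1.trans_le ht.1, ht.2.trans_lt hb.2⟩, hd⟩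
  rw [contDiff_infty_iff_deriv, hd]
  exact ⟨fun t => (hder t).differentiableAt, hψ⟩

/-- The lemma of du Bois-Reymond. -/
theorem eq_of_forall_integral_mul_deriv_eq_zero {w : ℝ → ℝ} (hw : ContinuousOn w (Icc 0 1))
    (h : ∀ φ : ℝ → ℝ, ContDiff ℝ ∞ φ → HasCompactSupport φ → tsupport φ ⊆ Ioo (0 : ℝ) 1 →
      ∫ t in (0 : ℝ)..1, w t * deriv φ t = 0) {t : ℝ} (ht : t ∈ Icc (0 : ℝ) 1) : w t = w 0 := by
  have hwi : ∀ {f : ℝ → ℝ}, Continuous f → IntervalIntegrable (fun t => w t * f t) volume 0 1 :=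
    fun hf => (ContinuousOn.mul (by rwa [uIcc_of_le zero_le_one]) hf.continuousOn).intervalIntegrable
  let η : ContDiffBump (1 / 2 : ℝ) := ⟨1 / 8, 1 / 4, by norm_num, by norm_num⟩
  have hηs : tsupport η ⊆ Ioo (0 : ℝ) 1 := by
    rw [η.tsupport_eq, Real.closedBall_eq_Icc]
    intro x hx
    have : η.rOut = 1 / 4 := rfl
    rw [this] at hx
    constructor <;> linarith [hx.1, hx.2]
  have hηc : Continuous η := η.continuous
  set A := ∫ t in (0 : ℝ)..1, η t with hA
  have hfull : ∀ f : ℝ → ℝ, tsupport f ⊆ Ioo (0 : ℝ) 1 → ∫ t, f t = ∫ t in (0 : ℝ)..1, f t := by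
    intro f hf
    rw [← setIntegral_Ioo_eq_intervalIntegral, setIntegral_eq_integral_of_forall_compl_eq_zero]
    exact fun x hx => eq_zero_of_tsupport_subset_Ioo hf hx
  have hA0 : A ≠ 0 := by
    rw [hA, ← hfull _ hηs]
    exact η.integral_pos.ne'
  set c := (∫ t in (0 : ℝ)..1, w t * η t) / A with hcdef
  have hae : ∀ᵐ t, t ∈ Ioo (0 : ℝ) 1 → w t - c = 0 := by
    refine isOpen_Ioo.ae_eq_zero_of_integral_contDiff_smul_eq_zero
      (ContinuousOn.locallyIntegrableOn ((hw.mono Ioo_subset_Icc_self).sub continuousOn_const)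
        measurableSet_Ioo) fun ψ hψ hψc hψs => ?_
    -- Subtracting `B` times the fixed bump makes the mean zero, so the difference is the derivative
    -- of a test function. The constant `c` is the `η`-weighted mean of `w`.
    set B := (∫ t in (0 : ℝ)..1, ψ t) / A with hB
    have hsm : ContDiff ℝ ∞ fun t => ψ t - B * η t := hψ.sub (contDiff_const.mul η.contDiff)
    have hsup : tsupport (fun t => ψ t - B * η t) ⊆ tsupport ψ ∪ tsupport η := by
      refine closure_minimal (fun t ht => ?_) ((isClosed_tsupport _).union (isClosed_tsupport _))
      by_contra hcon
      rw [mem_union, not_or] at hcon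
      exact ht (by
        change ψ t - B * η t = 0
        rw [image_eq_zero_of_notMem_tsupport hcon.1, image_eq_zero_of_notMem_tsupport hcon.2]
        ring)
    obtain ⟨φ, hφ, hφc, hφs, hd⟩ := exists_primitive_of_integral_eq_zero hsm
      ((hψc.isCompact.union η.hasCompactSupport.isCompact).of_isClosed_subset
        (isClosed_tsupport _) hsup) (hsup.trans (union_subset hψs hηs)) (by
        rw [intervalIntegral.integral_sub (hψ.continuous.intervalIntegrable _ _)
          ((hηc.intervalIntegrable _ _).const_mul _), intervalIntegral.integral_const_mul, ← hA, hB,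
          div_mul_cancel₀ _ hA0, sub_self])
    have h0 := h φ hφ hφc hφs
    rw [hd] at h0
    simp only [mul_sub] at h0
    have e : (fun t => w t * (B * η t)) = fun t => B * (w t * η t) := by ext; ring
    rw [intervalIntegral.integral_sub (hwi hψ.continuous) 
      (hwi (f := fun t => B * η t) (continuous_const.mul hηc)), e,
      intervalIntegral.integral_const_mul] at h0
    rw [hfull _ ((tsupport_smul_subset_left ψ _).trans hψs)]
    have e2 : (fun t => ψ t • (w t - c)) = fun t => w t * ψ t - c * ψ t := by
      ext; simp only [smul_eq_mul]; ring
    rw [e2, intervalIntegral.integral_sub (hwi hψ.continuous)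
      ((hψ.continuous.intervalIntegrable _ _).const_mul _), intervalIntegral.integral_const_mul]
    rw [hB] at h0
    rw [hcdef]
    linear_combination h0
  have heq : EqOn w (fun _ => c) (Icc 0 1) := by
    refine Measure.eqOn_Icc_of_ae_eq (μ := volume) zero_ne_one ?_ hw continuousOn_const
    rw [restrict_Ioo_eq_restrict_Icc.symm]
    exact (ae_restrict_iff' measurableSet_Ioo).2 (hae.mono fun t ht ht' => sub_eq_zero.1 (ht ht'))
  rw [heq ht, heq ⟨le_rfl, zero_le_one⟩]

/-- The fundamental theorem of calculus in `H¹(0,1)`. -/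
theorem HasH1Deriv.eq_add_integral {u v : ℝ → ℝ} (h : HasH1Deriv u v) {s t : ℝ}
    (hs : s ∈ Icc (0 : ℝ) 1) (ht : t ∈ Icc (0 : ℝ) 1) : u t = u s + ∫ x in s..t, v x := by
  obtain ⟨hc, -, hv, -, -, hw⟩ := h
  have h0 : (0 : ℝ) ∈ Icc (0 : ℝ) 1 := ⟨le_rfl, zero_le_one⟩
  have h1 : (1 : ℝ) ∈ Icc (0 : ℝ) 1 := ⟨zero_le_one, le_rfl⟩
  -- The primitive of `v` has the same weak derivative as `u`, so du Bois-Reymond applies to the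
  -- difference.
  have hU := hasH1Deriv_of_primitive (u := fun t => ∫ x in (0 : ℝ)..t, v x) hv (by simp)
  have key : ∀ t ∈ Icc (0 : ℝ) 1, u t - ∫ x in (0 : ℝ)..t, v x = u 0 := by
    intro t ht
    have := eq_of_forall_integral_mul_deriv_eq_zero
      (w := fun t => u t - ∫ x in (0 : ℝ)..t, v x) (hc.sub hU.1) (fun φ hφ hφc hφs => ?_) ht
    · simpa using this
    · have e1 := hw φ hφ hφc hφs
      have e2 := hU.2.2.2.2.2 φ hφ hφc hφs
      rw [setIntegral_Ioo_eq_intervalIntegral, setIntegral_Ioo_eq_intervalIntegral] at e1 e2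
      have hd : Continuous (deriv φ) := hφ.continuous_deriv (by exact_mod_cast le_top)
      simp only [sub_mul]
      rw [intervalIntegral.integral_sub, e1, e2, sub_self]
      · exact (ContinuousOn.mul (by rwa [uIcc_of_le zero_le_one])
          hd.continuousOn).intervalIntegrable
      · exact (ContinuousOn.mul (by rw [uIcc_of_le zero_le_one]; exact hU.1)
          hd.continuousOn).intervalIntegrable
  have e := intervalIntegral.integral_add_adjacent_intervals
    (hv.intervalIntegrable h0 hs) (hv.intervalIntegrable hs ht)
  linarith [key s hs, key t ht]

theorem HasH1Deriv.integral_mul_add_mul {u u' v v' : ℝ → ℝ} (hu : HasH1Deriv u u')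
    (hv : HasH1Deriv v v') {s t : ℝ} (hs : s ∈ Icc (0 : ℝ) 1) (ht : t ∈ Icc (0 : ℝ) 1)
    (hst : s ≤ t) :
    ∫ x in s..t, (u' x * v x + u x * v' x) = u t * v t - u s * v s :=
  integral_mul_add_mul_of_primitive hst (hu.2.2.1.intervalIntegrable hs ht)
    (hv.2.2.1.intervalIntegrable hs ht)
    (fun _ hx => hu.eq_add_integral hs ⟨hs.1.trans hx.1, hx.2.trans ht.2⟩)
    (fun _ hx => hv.eq_add_integral hs ⟨hs.1.trans hx.1, hx.2.trans ht.2⟩)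

theorem memL2_of_continuous {f : ℝ → ℝ} (hf : Continuous f) : MemL2 f := by
  obtain ⟨C, hC⟩ := (isCompact_Icc (a := (0 : ℝ)) (b := 1)).exists_bound_of_continuousOn
    hf.continuousOn
  exact MemLp.of_bound hf.aestronglyMeasurable C ((ae_restrict_iff' measurableSet_Ioo).2
    (Filter.Eventually.of_forall fun t ht => hC t (Ioo_subset_Icc_self ht)))

theorem hasH1Deriv_of_contDiff {φ : ℝ → ℝ} (hφ : ContDiff ℝ 1 φ) : HasH1Deriv φ (deriv φ) :=
  hasH1Deriv_of_primitive (memL2_of_continuous (hφ.continuous_deriv le_rfl))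
    fun t _ => eq_add_integral_deriv_of_contDiff hφ 0 t

end Calculus

/-! ### The Hamiltonian and discrete calculus on the graph. -/

section Graph

variable {n : ℕ} {G : WeightedGraph n} {g : ℝ → ℝ → ℝ}

/-- The extension of a function on the quadrant `[0,∞)²` to the plane. -/
def extendQuadrant (g : ℝ → ℝ → ℝ) : ℝ → ℝ → ℝ := fun r s => g (max r 0) (max s 0)

theorem extendQuadrant_of_nonneg {r s : ℝ} (hr : 0 ≤ r) (hs : 0 ≤ s) :
    extendQuadrant g r s = g r s := by
  rw [extendQuadrant, max_eq_left hr, max_eq_left hs]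

theorem IsMobility.extendQuadrant_nonneg (hg : IsMobility g) (r s : ℝ) :
    0 ≤ extendQuadrant g r s :=
  hg.nonneg _ _ (le_max_right _ _) (le_max_right _ _)

/-- Clamping the arguments at zero gives integrands continuous on the whole space, so that
compositions with curves and suprema over the simplex carry no domain conditions. -/
theorem IsMobility.continuous_extendQuadrant (hg : IsMobility g) :
    Continuous fun p : ℝ × ℝ => extendQuadrant g p.1 p.2 :=
  hg.continuousOn.comp_continuous (f := fun p : ℝ × ℝ => (max p.1 0, max p.2 0)) (by fun_prop)
    fun p => ⟨le_max_right p.1 0, le_max_right p.2 0⟩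

theorem normSq_extendQuadrant {ρ : Fin n → ℝ} (hρ : ∀ i, 0 ≤ ρ i)
    (b : Matrix (Fin n) (Fin n) ℝ) : normSq G (extendQuadrant g) ρ b = normSq G g ρ b := by
  simp only [normSq, extendQuadrant_of_nonneg (hρ _) (hρ _)]

theorem IsMobility.continuous_normSq (hg : IsMobility g) :
    Continuous fun p : (Fin n → ℝ) × Matrix (Fin n) (Fin n) ℝ =>
      normSq G (extendQuadrant g) p.1 p.2 := by
  unfold normSq
  refine continuous_const.mul (continuous_finsetSum _ fun e _ => ?_)
  have h1 : Continuous fun p : (Fin n → ℝ) × Matrix (Fin n) (Fin n) ℝ => p.2 e.1 e.2 :=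
    continuous_snd.matrix_elem _ _
  have h2 : Continuous fun p : (Fin n → ℝ) × Matrix (Fin n) (Fin n) ℝ =>
      extendQuadrant g (p.1 e.1) (p.1 e.2) :=
    hg.continuous_extendQuadrant.comp
      (g := fun p : ℝ × ℝ => extendQuadrant g p.1 p.2)
      (f := fun p : (Fin n → ℝ) × Matrix (Fin n) (Fin n) ℝ => (p.1 e.1, p.1 e.2)) (by fun_prop)
  exact (h1.pow 2).mul h2

/-- The function maximized in the definition of the Hamiltonian. -/
noncomputable def lagrangian (G : WeightedGraph n) (g : ℝ → ℝ → ℝ) (a : Fin n → ℝ)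
    (b : Matrix (Fin n) (Fin n) ℝ) (ρ : Fin n → ℝ) : ℝ :=
  ∑ i, a i * ρ i + 1 / 2 * normSq G g ρ b

theorem lagrangian_extendQuadrant {ρ : Fin n → ℝ} (hρ : ∀ i, 0 ≤ ρ i) (a : Fin n → ℝ)
    (b : Matrix (Fin n) (Fin n) ℝ) :
    lagrangian G (extendQuadrant g) a b ρ = lagrangian G g a b ρ := by
  rw [lagrangian, lagrangian, normSq_extendQuadrant hρ]

theorem IsMobility.continuous_lagrangian (hg : IsMobility g) :
    Continuous fun p : ((Fin n → ℝ) × Matrix (Fin n) (Fin n) ℝ) × (Fin n → ℝ) =>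
      lagrangian G (extendQuadrant g) p.1.1 p.1.2 p.2 := by
  unfold lagrangian
  refine Continuous.add (by fun_prop) (continuous_const.mul ?_)
  exact hg.continuous_normSq.comp (continuous_snd.prodMk (continuous_snd.comp continuous_fst))

theorem hamiltonian_eq_sSup (a : Fin n → ℝ) (b : Matrix (Fin n) (Fin n) ℝ) :
    hamiltonian G g a b =
      sSup (lagrangian G (extendQuadrant g) a b '' stdSimplex ℝ (Fin n)) :=
  congrArg sSup (image_congr fun _ hρ => (lagrangian_extendQuadrant hρ.1 a b).symm)

theorem WeightedGraph.nonempty_stdSimplex (G : WeightedGraph n) :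
    (stdSimplex ℝ (Fin n)).Nonempty :=
  let ⟨i⟩ := G.connected.nonempty
  ⟨_, single_mem_stdSimplex ℝ i⟩

theorem IsMobility.isLUB_hamiltonian (hg : IsMobility g) (a : Fin n → ℝ)
    (b : Matrix (Fin n) (Fin n) ℝ) :
    IsLUB (lagrangian G (extendQuadrant g) a b '' stdSimplex ℝ (Fin n)) (hamiltonian G g a b) := by
  rw [hamiltonian_eq_sSup]
  refine isLUB_csSup (G.nonempty_stdSimplex.image _) ?_
  refine ((isCompact_stdSimplex ℝ (Fin n)).image ?_).bddAbove
  have h : Continuous fun ρ : Fin n → ℝ => ((a, b), ρ) := by fun_prop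
  exact (hg.continuous_lagrangian (G := G)).comp h

theorem IsMobility.lagrangian_le_hamiltonian (hg : IsMobility g) {ρ : Fin n → ℝ}
    (hρ : ρ ∈ stdSimplex ℝ (Fin n)) (a : Fin n → ℝ) (b : Matrix (Fin n) (Fin n) ℝ) :
    lagrangian G g a b ρ ≤ hamiltonian G g a b := by
  rw [← lagrangian_extendQuadrant hρ.1]
  exact (hg.isLUB_hamiltonian a b).1 (mem_image_of_mem _ hρ)

theorem IsMobility.continuous_hamiltonian (hg : IsMobility g) :
    Continuous fun p : (Fin n → ℝ) × Matrix (Fin n) (Fin n) ℝ => hamiltonian G g p.1 p.2 := by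
  simp only [hamiltonian_eq_sSup]
  exact (isCompact_stdSimplex ℝ (Fin n)).continuous_sSup
    (f := fun (p : (Fin n → ℝ) × Matrix (Fin n) (Fin n) ℝ) ρ =>
      lagrangian G (extendQuadrant g) p.1 p.2 ρ) hg.continuous_lagrangian

/-- Densities have total mass one, so the constant leaves the supremum. This is what permits
correcting a curve into a Hamilton-Jacobi solution. -/
theorem IsMobility.hamiltonian_sub_const (hg : IsMobility g) (a : Fin n → ℝ)
    (b : Matrix (Fin n) (Fin n) ℝ) (c : ℝ) :
    hamiltonian G g (fun i => a i - c) b = hamiltonian G g a b - c := by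
  have hlag : ∀ ρ ∈ stdSimplex ℝ (Fin n), lagrangian G (extendQuadrant g) (fun i => a i - c) b ρ =
      lagrangian G (extendQuadrant g) a b ρ - c := by
    intro ρ hρ
    simp only [lagrangian, sub_mul, Finset.sum_sub_distrib, ← Finset.mul_sum, hρ.2]
    ring
  refine (hg.isLUB_hamiltonian _ b).unique ⟨?_, ?_⟩
  · rintro _ ⟨ρ, hρ, rfl⟩
    rw [hlag ρ hρ]
    linarith [(hg.isLUB_hamiltonian (G := G) a b).1 (mem_image_of_mem _ hρ)]
  · intro y hy
    have : hamiltonian G g a b ≤ y + c := by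
      refine (hg.isLUB_hamiltonian a b).2 ?_
      rintro _ ⟨ρ, hρ, rfl⟩
      have := hy (mem_image_of_mem _ hρ)
      rw [hlag ρ hρ] at this
      linarith
    linarith

theorem grad_skew (G : WeightedGraph n) (φ : Fin n → ℝ) (i j : Fin n) :
    grad G φ j i = -grad G φ i j := by
  unfold grad
  by_cases h : G.graph.Adj i j
  · rw [if_pos h, if_pos h.symm, G.weight_symm.apply]; ring
  · rw [if_neg h, if_neg fun h' => h h'.symm, neg_zero]

theorem mem_edges {e : Fin n × Fin n} : e ∈ G.edges ↔ G.graph.Adj e.1 e.2 := by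
  simp [WeightedGraph.edges]

theorem sum_edges_swap (f : Fin n → Fin n → ℝ) :
    ∑ e ∈ G.edges, f e.2 e.1 = ∑ e ∈ G.edges, f e.1 e.2 := by
  refine Finset.sum_nbij' Prod.swap Prod.swap ?_ ?_ ?_ ?_ ?_ <;>
    simp [mem_edges, SimpleGraph.adj_comm]

theorem sum_edges_eq_sum_nbr (f : Fin n → Fin n → ℝ) :
    ∑ e ∈ G.edges, f e.1 e.2 = ∑ i, ∑ j ∈ G.nbr i, f i j := by
  classical
  simp only [WeightedGraph.edges, WeightedGraph.nbr, Finset.sum_filter, Fintype.sum_prod_type]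

/-- The discrete integration by parts. -/
theorem sum_mul_divergence {m : Matrix (Fin n) (Fin n) ℝ} (hm : m.transpose = -m)
    (φ : Fin n → ℝ) :
    ∑ i, φ i * -divergence G m i = 1 / 2 * ∑ e ∈ G.edges, m e.1 e.2 * grad G φ e.1 e.2 := by
  have hm' : ∀ i j, m j i = -m i j := fun i j => congrFun (congrFun hm i) j
  have h1 : ∑ i, φ i * -divergence G m i =
      ∑ e ∈ G.edges, √(G.weight e.1 e.2) * m e.1 e.2 * φ e.1 := by
    rw [sum_edges_eq_sum_nbr fun i j => √(G.weight i j) * m i j * φ i]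
    refine Finset.sum_congr rfl fun i _ => ?_
    rw [divergence, ← Finset.sum_neg_distrib, Finset.mul_sum]
    refine Finset.sum_congr rfl fun j _ => ?_
    rw [hm' i j]; ring
  have h2 := sum_edges_swap (G := G) fun i j => √(G.weight i j) * m i j * φ i
  have h3 : ∑ e ∈ G.edges, m e.1 e.2 * grad G φ e.1 e.2 =
      ∑ e ∈ G.edges, √(G.weight e.1 e.2) * m e.1 e.2 * φ e.1 +
      ∑ e ∈ G.edges, √(G.weight e.2 e.1) * m e.2 e.1 * φ e.2 := by
    rw [← Finset.sum_add_distrib]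
    refine Finset.sum_congr rfl fun e he => ?_
    rw [grad, if_pos (mem_edges.1 he), hm' e.1 e.2, G.weight_symm.apply e.1 e.2]
    ring
  rw [h1, h3, h2]
  ring

/-- For `x ≤ 1/2` the point `(1 - x, x)` lies on the segment from `(1, 0)`, where `g ≥ 0`, to `(1/2,
1/2)`; concavity gives a linear lower bound, and symmetry covers the other half. -/
theorem IsMobility.two_mul_mul_le (hg : IsMobility g) {r : ℝ} (h0 : 0 ≤ r) (h1 : r ≤ 1) :
    2 * g (1 / 2) (1 / 2) * (r * (1 - r)) ≤ g (1 - r) r := by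
  have hγ := hg.pos (1 / 2) (1 / 2) (by norm_num) (by norm_num)
  have key : ∀ x : ℝ, 0 ≤ x → x ≤ 1 / 2 → 2 * g (1 / 2) (1 / 2) * x ≤ g (1 - x) x := by
    intro x hx hx'
    have h := hg.concaveOn.2 (x := ((1 / 2 : ℝ), (1 / 2 : ℝ))) (y := ((1 : ℝ), (0 : ℝ)))
      ⟨by norm_num [mem_Ici], by norm_num [mem_Ici]⟩ ⟨by norm_num [mem_Ici], by norm_num [mem_Ici]⟩
      (show 0 ≤ 2 * x by linarith) (show 0 ≤ 1 - 2 * x by linarith) (by ring)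
    simp only [smul_eq_mul, Prod.smul_mk, Prod.mk_add_mk] at h
    rw [show 2 * x * (1 / 2) + (1 - 2 * x) * 1 = 1 - x by ring,
      show 2 * x * (1 / 2) + (1 - 2 * x) * 0 = x by ring] at h
    have h2 := mul_nonneg (show 0 ≤ 1 - 2 * x by linarith) (hg.nonneg 1 0 zero_le_one le_rfl)
    linarith
  rcases le_total r (1 / 2) with h | h
  · have := key r h0 h
    nlinarith [mul_nonneg h0 h0]
  · have := key (1 - r) (by linarith) (by linarith)
    rw [sub_sub_cancel, hg.symm r (1 - r) h0 (by linarith)] at this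
    nlinarith [mul_nonneg (sub_nonneg.2 h1) (sub_nonneg.2 h1)]

/-! ### A priori bounds for subsolutions, and weak duality. -/

/-- `H¹` subsolutions of the Hamilton-Jacobi equation. -/
structure IsSubsolution (G : WeightedGraph n) (g : ℝ → ℝ → ℝ) (l l' : ℝ → Fin n → ℝ) : Prop where
  hasH1Deriv : ∀ i, HasH1Deriv (fun t => l t i) fun t => l' t i
  lagrangian_le : ∀ᵐ t ∂volume.restrict (Ioo (0 : ℝ) 1), ∀ ρ ∈ stdSimplex ℝ (Fin n),
    lagrangian G g (l' t) (grad G (l t)) ρ ≤ 0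

theorem IsMobility.isSubsolution (hg : IsMobility g) {l l' : ℝ → Fin n → ℝ}
    (h1 : ∀ i, HasH1Deriv (fun t => l t i) fun t => l' t i)
    (h2 : ∀ᵐ t ∂volume.restrict (Ioo (0 : ℝ) 1), hamiltonian G g (l' t) (grad G (l t)) = 0) :
    IsSubsolution G g l l' :=
  ⟨h1, h2.mono fun _ ht _ hρ => (hg.lagrangian_le_hamiltonian hρ _ _).trans ht.le⟩

theorem IsMobility.normSq_nonneg (hg : IsMobility g) {ρ : Fin n → ℝ} (hρ : ∀ i, 0 ≤ ρ i)
    (b : Matrix (Fin n) (Fin n) ℝ) : 0 ≤ normSq G g ρ b :=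
  mul_nonneg (by norm_num) (Finset.sum_nonneg fun e _ =>
    mul_nonneg (sq_nonneg _) (hg.nonneg _ _ (hρ _) (hρ _)))

theorem ae_restrict_of_Ioo {p : ℝ → Prop} (h : ∀ᵐ t ∂volume.restrict (Ioo (0 : ℝ) 1), p t)
    {s t : ℝ} (hs : 0 ≤ s) (ht : t ≤ 1) : ∀ᵐ x ∂volume.restrict (Icc s t), p x := by
  rw [← restrict_Ioo_eq_restrict_Icc]
  exact ae_restrict_of_ae_restrict_of_subset (Ioo_subset_Ioo hs ht) h

/-- Testing with unit mass at `i` and dropping the nonnegative gradient term gives `λ̇_i ≤ 0`. -/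
theorem IsSubsolution.antitone (hg : IsMobility g) {l l' : ℝ → Fin n → ℝ}
    (hl : IsSubsolution G g l l') (i : Fin n) {s t : ℝ} (hs : 0 ≤ s) (hst : s ≤ t) (ht : t ≤ 1) :
    l t i ≤ l s i := by
  rw [(hl.hasH1Deriv i).eq_add_integral ⟨hs, hst.trans ht⟩ ⟨hs.trans hst, ht⟩]
  have : ∫ x in s..t, l' x i ≤ ∫ x in s..t, (0 : ℝ) := by
    refine intervalIntegral.integral_mono_ae_restrict hst
      ((hl.hasH1Deriv i).2.2.1.intervalIntegrable ⟨hs, hst.trans ht⟩ ⟨hs.trans hst, ht⟩)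
      (by simp) ?_
    filter_upwards [ae_restrict_of_Ioo hl.lagrangian_le hs ht] with x hx
    have h := hx _ (single_mem_stdSimplex ℝ i)
    have hn := hg.normSq_nonneg (G := G) (single_mem_stdSimplex ℝ i).1 (grad G (l x))
    simp only [lagrangian, Pi.single_apply, mul_ite, mul_one, mul_zero, Finset.sum_ite_eq',
      Finset.mem_univ, if_true] at h
    linarith
  simpa using this

/-- The Hamilton-Jacobi inequality, tested with masses `1 - r` and `r` at two adjacent vertices. -/
theorem IsMobility.lagrangian_edge_ge (hg : IsMobility g) {i j : Fin n} (hij : G.graph.Adj i j)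
    {r : ℝ} (h0 : 0 ≤ r) (h1 : r ≤ 1) {a φ : Fin n → ℝ}
    (h : ∀ ρ ∈ stdSimplex ℝ (Fin n), lagrangian G g a (grad G φ) ρ ≤ 0) :
    a i * (1 - r) + a j * r +
      G.weight i j * g (1 / 2) (1 / 2) * (r * (1 - r)) * (φ j - φ i) ^ 2 ≤ 0 := by
  classical
  have hne : i ≠ j := hij.ne
  set ρ : Fin n → ℝ := (1 - r) • Pi.single i 1 + r • Pi.single j 1 with hρ
  have hmem : ρ ∈ stdSimplex ℝ (Fin n) :=
    convex_stdSimplex ℝ (Fin n) (single_mem_stdSimplex ℝ i) (single_mem_stdSimplex ℝ j)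
      (by linarith) h0 (by ring)
  have hi : ρ i = 1 - r := by simp [hρ, hne]
  have hj : ρ j = r := by simp [hρ, hne.symm]
  have hsum : ∑ k, a k * ρ k = a i * (1 - r) + a j * r := by
    simp [hρ, mul_add, Finset.sum_add_distrib, Pi.single_apply]
  have hω := G.weight_pos i j hij
  have hnorm : G.weight i j * (φ j - φ i) ^ 2 * g (1 - r) r ≤ normSq G g ρ (grad G φ) := by
    -- Only the two orientations of the edge are kept; all other terms are nonnegative.
    have hsub : ({(i, j), (j, i)} : Finset (Fin n × Fin n)) ⊆ G.edges := by
      intro e he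
      simp only [Finset.mem_insert, Finset.mem_singleton] at he
      rcases he with rfl | rfl
      · exact mem_edges.2 hij
      · exact mem_edges.2 hij.symm
    have hle := Finset.sum_le_sum_of_subset_of_nonneg
      (f := fun e : Fin n × Fin n => grad G φ e.1 e.2 ^ 2 * g (ρ e.1) (ρ e.2)) hsub
      fun e _ _ => mul_nonneg (sq_nonneg _) (hg.nonneg _ _ (hmem.1 _) (hmem.1 _))
    rw [Finset.sum_pair (by simp [hne]), hi, hj, grad_skew G φ i j,
      hg.symm r (1 - r) h0 (by linarith)] at hle
    have hgr : grad G φ i j ^ 2 = G.weight i j * (φ j - φ i) ^ 2 := by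
      rw [grad, if_pos hij, mul_pow, Real.sq_sqrt hω.le]; ring
    rw [neg_sq, hgr] at hle
    rw [normSq]
    linarith
  have hl := h ρ hmem
  rw [lagrangian, hsum] at hl
  have hγ := mul_le_mul_of_nonneg_left (hg.two_mul_mul_le h0 h1)
    (mul_nonneg hω.le (sq_nonneg (φ j - φ i)))
  linarith

/-- The function `λ_i (1 - r) + λ_j r` runs from `λ_i(s)` to `λ_j(t)` as `r` moves the mass from `i`
to `j`. With `d = λ_j - λ_i`, its derivative is at most `r' d - κ r(1-r) d²`, and completing the
square bounds this by `r'² / (4 κ r(1-r))`. -/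
theorem IsSubsolution.le_of_adj (hg : IsMobility g) {i j : Fin n} (hij : G.graph.Adj i j)
    {l l' : ℝ → Fin n → ℝ} (hl : IsSubsolution G g l l') {s t : ℝ} (hs : 0 ≤ s) (hst : s < t)
    (ht : t ≤ 1) :
    l t j - l s i ≤ 3 / (G.weight i j * g (1 / 2) (1 / 2)) / (t - s) := by
  have hκ : 0 < G.weight i j * g (1 / 2) (1 / 2) :=
    mul_pos (G.weight_pos i j hij) (hg.pos _ _ (by norm_num) (by norm_num))
  set κ := G.weight i j * g (1 / 2) (1 / 2) with hκdef
  set T := t - s with hT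
  have hT0 : 0 < T := sub_pos.2 hst
  have hsI : s ∈ Icc (0 : ℝ) 1 := ⟨hs, hst.le.trans ht⟩
  have htI : t ∈ Icc (0 : ℝ) 1 := ⟨hs.trans hst.le, ht⟩
  -- The cubic `3x² - 2x³` has a derivative vanishing at both ends, which keeps `r'² / (r(1-r))`
  -- bounded: `r(1-r) ≥ 3 (x(1-x))²`, whence the constant `3/κ`.
  set r : ℝ → ℝ := fun τ => ((τ - s) / T) ^ 2 * (3 - 2 * ((τ - s) / T)) with hr
  set r' : ℝ → ℝ := fun τ => 6 * ((τ - s) / T) * (1 - (τ - s) / T) / T with hr'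
  have hder : ∀ τ, HasDerivAt r (r' τ) τ := by
    intro τ
    have hx : HasDerivAt (fun τ => (τ - s) / T) (1 / T) τ :=
      ((hasDerivAt_id τ).sub_const s).div_const T
    refine ((hx.pow 2).mul ((hx.const_mul 2).const_sub 3)).congr_deriv ?_
    simp only [hr', Pi.pow_apply]
    ring
  have hrc : ContDiff ℝ 1 r := by rw [hr]; fun_prop
  have hdr : deriv r = r' := funext fun τ => (hder τ).deriv
  have hH := hasH1Deriv_of_contDiff hrc
  rw [hdr] at hH
  have hH' := hasH1Deriv_of_contDiff (contDiff_const (c := (1 : ℝ)).sub hrc)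
  have hdr' : deriv (fun τ => 1 - r τ) = fun τ => -r' τ :=
    funext fun τ => ((hder τ).const_sub 1).deriv
  rw [hdr'] at hH'
  have e1 := (hl.hasH1Deriv i).integral_mul_add_mul hH' hsI htI hst.le
  have e2 := (hl.hasH1Deriv j).integral_mul_add_mul hH hsI htI hst.le
  have hr's : r s = 0 := by simp [hr]
  have hrt : r t = 1 := by simp only [hr, ← hT, div_self hT0.ne']; norm_num
  have hcl : ∀ k, ContinuousOn (fun x => l x k) (uIcc s t) := fun k =>
    (hl.hasH1Deriv k).1.mono (uIcc_subset_Icc hsI htI)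
  have hil : ∀ k, IntervalIntegrable (fun x => l' x k) volume s t := fun k =>
    (hl.hasH1Deriv k).2.2.1.intervalIntegrable hsI htI
  have hrcont : Continuous r := hrc.continuous
  have hr'cont : Continuous r' := by rw [hr']; fun_prop
  have i1 : IntervalIntegrable (fun x => l' x i * (1 - r x) + l x i * -r' x) volume s t :=
    ((hil i).mul_continuousOn (continuous_const.sub hrcont).continuousOn).add
      ((hcl i).mul hr'cont.neg.continuousOn).intervalIntegrable
  have i2 : IntervalIntegrable (fun x => l' x j * r x + l x j * r' x) volume s t :=
    ((hil j).mul_continuousOn hrcont.continuousOn).add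
      ((hcl j).mul hr'cont.continuousOn).intervalIntegrable
  have hint := intervalIntegral.integral_add i1 i2
  rw [e1, e2, hr's, hrt] at hint
  have hmono : ∫ x in s..t, (l' x i * (1 - r x) + l x i * -r' x + (l' x j * r x + l x j * r' x)) ≤
      ∫ x in s..t, 3 / κ / T ^ 2 := by
    refine intervalIntegral.integral_mono_ae_restrict hst.le (i1.add i2) (by simp) ?_
    filter_upwards [ae_restrict_of_Ioo hl.lagrangian_le hs ht,
      ae_restrict_mem measurableSet_Icc] with τ hτ hτI
    have hx0 : 0 ≤ (τ - s) / T := div_nonneg (by linarith [hτI.1]) hT0.le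
    have hx1 : (τ - s) / T ≤ 1 := (div_le_one hT0).2 (by linarith [hτI.2])
    have hrdef : r τ = ((τ - s) / T) ^ 2 * (3 - 2 * ((τ - s) / T)) := rfl
    have hr'def : r' τ = 6 * ((τ - s) / T) * (1 - (τ - s) / T) / T := rfl
    set x := (τ - s) / T
    have h1r : 1 - r τ = (1 - x) ^ 2 * (1 + 2 * x) := by rw [hrdef]; ring
    have hr0 : 0 ≤ r τ := by rw [hrdef]; exact mul_nonneg (sq_nonneg _) (by linarith)
    have hr1 : r τ ≤ 1 := by
      have : 0 ≤ 1 - r τ := by rw [h1r]; exact mul_nonneg (sq_nonneg _) (by linarith)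
      linarith
    have hprod : 3 * (x * (1 - x)) ^ 2 ≤ r τ * (1 - r τ) := by
      rw [h1r, hrdef]
      have : 0 ≤ (x * (1 - x)) ^ 2 * (x * (1 - x)) :=
        mul_nonneg (sq_nonneg _) (mul_nonneg hx0 (sub_nonneg.2 hx1))
      nlinarith
    have hedge := hg.lagrangian_edge_ge hij hr0 hr1 hτ
    set d := l τ j - l τ i with hd
    have hy : r' τ * d ≤ κ * (3 * (x * (1 - x)) ^ 2) * d ^ 2 + 3 / κ / T ^ 2 := by
      have hsq : κ * (3 * (x * (1 - x)) ^ 2) * d ^ 2 + 3 / κ / T ^ 2 - r' τ * d =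
          3 / κ * (κ * (x * (1 - x)) * d - 1 / T) ^ 2 := by
        rw [hr'def]; field_simp; ring
      have : 0 ≤ 3 / κ * (κ * (x * (1 - x)) * d - 1 / T) ^ 2 := by positivity
      linarith
    have hp := mul_le_mul_of_nonneg_right (mul_le_mul_of_nonneg_left hprod hκ.le) (sq_nonneg d)
    have hgoal : l' τ i * (1 - r τ) + l τ i * -r' τ + (l' τ j * r τ + l τ j * r' τ) =
        l' τ i * (1 - r τ) + l' τ j * r τ + r' τ * d := by rw [hd]; ring
    change l' τ i * (1 - r τ) + l τ i * -r' τ + (l' τ j * r τ + l τ j * r' τ) ≤ 3 / κ / T ^ 2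
    rw [hgoal]
    linarith
  rw [hint, intervalIntegral.integral_const, smul_eq_mul, ← hT] at hmono
  have : T * (3 / κ / T ^ 2) = 3 / κ / T := by field_simp
  rw [this] at hmono
  linarith

/-- Induction along a walk from `i` to `j`: the first half of the time interval serves the first
edge, the second half the rest, which explains the factors `2`. -/
theorem exists_subsolution_bound (hg : IsMobility g) (i j : Fin n) :
    ∃ C : ℝ, ∀ l l' : ℝ → Fin n → ℝ, IsSubsolution G g l l' → ∀ s t : ℝ, 0 ≤ s → s < t → t ≤ 1 →
      l t j - l s i ≤ C / (t - s) := by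
  obtain ⟨w⟩ := G.connected.preconnected i j
  induction w with
  | nil =>
    refine ⟨0, fun l l' hl s t hs hst ht => ?_⟩
    rw [zero_div, sub_nonpos]
    exact hl.antitone hg _ hs hst.le ht
  | @cons a b c hab w ih =>
    obtain ⟨C, hC⟩ := ih
    refine ⟨2 * (3 / (G.weight a b * g (1 / 2) (1 / 2))) + 2 * C, fun l l' hl s t hs hst ht => ?_⟩
    have h1 := hl.le_of_adj hg hab hs (show s < (s + t) / 2 by linarith) (by linarith)
    have h2 := hC l l' hl ((s + t) / 2) t (by linarith) (by linarith) ht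
    rw [show (s + t) / 2 - s = (t - s) / 2 by ring] at h1
    rw [show t - (s + t) / 2 = (t - s) / 2 by ring] at h2
    rw [div_div_eq_mul_div] at h1 h2
    rw [add_div, mul_comm 2, mul_comm 2]
    linarith

/-- With the product coupling `ρ0 i * ρ1 j`, the boundary term becomes an average of the differences
`λ_j(1) - λ_i(0)`. -/
theorem bddAbove_dualValues (hg : IsMobility g) {ρ0 ρ1 : Fin n → ℝ}
    (hρ0 : ρ0 ∈ stdSimplex ℝ (Fin n)) (hρ1 : ρ1 ∈ stdSimplex ℝ (Fin n)) :
    BddAbove (dualValues G g ρ0 ρ1) := by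
  choose C hC using fun i j => exists_subsolution_bound (G := G) hg i j
  refine ⟨∑ i, ∑ j, ρ0 i * ρ1 j * C i j, ?_⟩
  rintro _ ⟨l, l', h1, h2, rfl⟩
  have hl := hg.isSubsolution h1 h2
  have e : ∑ i, l 1 i * ρ1 i - ∑ i, l 0 i * ρ0 i =
      ∑ i, ∑ j, ρ0 i * ρ1 j * (l 1 j - l 0 i) := by
    have e1 : ∑ i, ∑ j, ρ0 i * ρ1 j * l 1 j = ∑ i, l 1 i * ρ1 i := by
      simp only [mul_assoc, ← Finset.mul_sum, ← Finset.sum_mul, hρ0.2, one_mul, mul_comm]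
    have e2 : ∑ i, ∑ j, ρ0 i * ρ1 j * l 0 i = ∑ i, l 0 i * ρ0 i := by
      refine Finset.sum_congr rfl fun i _ => ?_
      rw [← Finset.sum_mul, ← Finset.mul_sum, hρ1.2]; ring
    simp only [mul_sub, Finset.sum_sub_distrib, e1, e2]
  rw [e]
  refine Finset.sum_le_sum fun i _ => Finset.sum_le_sum fun j _ =>
    mul_le_mul_of_nonneg_left ?_ (mul_nonneg (hρ0.1 i) (hρ1.1 j))
  simpa using hC i j l l' hl 0 1 le_rfl zero_lt_one le_rfl

/-- Young's inequality on one edge, by completing the square when `q > 0`; otherwise the left side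
is zero or the right side infinite. -/
theorem ofReal_mul_sub_le_kinetic (q m b : ℝ) :
    ENNReal.ofReal (m * b - 1 / 2 * (b ^ 2 * q)) ≤ 1 / 2 * kinetic q m := by
  unfold kinetic
  split_ifs with h1 h2
  · rw [show (1 / 2 : ℝ≥0∞) = ENNReal.ofReal (1 / 2) by
      rw [ENNReal.ofReal_div_of_pos two_pos]; simp, ← ENNReal.ofReal_mul (by norm_num)]
    refine ENNReal.ofReal_le_ofReal ?_
    have : 1 / 2 * (m ^ 2 / q) - (m * b - 1 / 2 * (b ^ 2 * q)) =
        1 / 2 * ((m - b * q) ^ 2 / q) := by field_simp; ring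
    have h3 : 0 ≤ 1 / 2 * ((m - b * q) ^ 2 / q) := by positivity
    linarith
  · rw [h2.1, h2.2]; simp
  · simp [ENNReal.mul_top]

/-- Weak duality. -/
theorem dualValue_le_action (hg : IsMobility g) {ρ0 ρ1 : Fin n → ℝ}
    {p : (ℝ → Fin n → ℝ) × (ℝ → Matrix (Fin n) (Fin n) ℝ)} (hp : p ∈ admissible G ρ0 ρ1)
    {x : ℝ} (hx : x ∈ dualValues G g ρ0 ρ1) : ENNReal.ofReal x ≤ action G g p.1 p.2 := by
  obtain ⟨ρ, m⟩ := p
  obtain ⟨hρ, hH, hskew, hm, h0, h1, hw⟩ := hp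
  obtain ⟨l, l', hl1, hl2, rfl⟩ := hx
  have hl := hg.isSubsolution hl1 hl2
  have hdiv : ∀ i, HasH1Deriv (fun t => ρ t i) fun t => -divergence G (m t) i := by
    intro i
    obtain ⟨v, hv1, hv2, -, -⟩ := hH i
    refine ⟨hv1, hv2, ?_, hw i⟩
    refine MemLp.neg (memLp_finsetSum _ fun j hj => (hm j i ?_).const_mul _)
    simp only [WeightedGraph.nbr, Finset.mem_filter] at hj
    exact hj.2.symm
  have h0I : (0 : ℝ) ∈ Icc (0 : ℝ) 1 := ⟨le_rfl, zero_le_one⟩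
  have h1I : (1 : ℝ) ∈ Icc (0 : ℝ) 1 := ⟨zero_le_one, le_rfl⟩
  set f : ℝ → ℝ := fun t => ∑ i, (l' t i * ρ t i + l t i * -divergence G (m t) i) with hf
  have hi : ∀ i, IntervalIntegrable
      (fun t => l' t i * ρ t i + l t i * -divergence G (m t) i) volume 0 1 := fun i =>
    (((hl1 i).2.2.1.intervalIntegrable h0I h1I).mul_continuousOn
      (by rw [uIcc_of_le zero_le_one]; exact (hdiv i).1)).add
    (((hdiv i).2.2.1.intervalIntegrable h0I h1I).continuousOn_mul
      (by rw [uIcc_of_le zero_le_one]; exact (hl1 i).1))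
  have hint : ∫ t in Ioo (0 : ℝ) 1, f t = ∑ i, l 1 i * ρ1 i - ∑ i, l 0 i * ρ0 i := by
    rw [setIntegral_Ioo_eq_intervalIntegral, hf, intervalIntegral.integral_finsetSum fun i _ => hi i,
      ← Finset.sum_sub_distrib]
    refine Finset.sum_congr rfl fun i _ => ?_
    rw [(hl1 i).integral_mul_add_mul (hdiv i) h0I h1I zero_le_one]
    simp only at h0 h1
    rw [h0, h1]
  rw [← hint]
  have hfi : Integrable f (volume.restrict (Ioo (0 : ℝ) 1)) :=
    integrable_finsetSum _ fun i _ =>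
      (intervalIntegrable_iff_integrableOn_Ioo_of_le zero_le_one).1 (hi i)
  -- Passing to positive parts avoids any integrability requirement on the kinetic energy.
  have hle : ENNReal.ofReal (∫ t in Ioo (0 : ℝ) 1, f t) ≤
      ∫⁻ t in Ioo (0 : ℝ) 1, ENNReal.ofReal (f t) := by
    rw [integral_eq_lintegral_pos_part_sub_lintegral_neg_part hfi]
    refine (ENNReal.ofReal_le_ofReal (sub_le_self _ ENNReal.toReal_nonneg)).trans ?_
    exact ENNReal.ofReal_toReal_le
  refine hle.trans ?_
  rw [action, ← lintegral_const_mul' _ _ (by simp)]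
  refine lintegral_mono_ae ?_
  filter_upwards [hl.lagrangian_le, hskew, ae_restrict_mem measurableSet_Ioo] with t ht hs htI
  have hρt := hρ t (Ioo_subset_Icc_self htI)
  have h2 := ht _ hρt
  have h3 := sum_mul_divergence (G := G) hs (l t)
  have h4 : f t ≤ 1 / 2 * ∑ e ∈ G.edges, (m t e.1 e.2 * grad G (l t) e.1 e.2 -
      1 / 2 * (grad G (l t) e.1 e.2 ^ 2 * g (ρ t e.1) (ρ t e.2))) := by
    rw [Finset.sum_sub_distrib, ← Finset.mul_sum]
    simp only [hf, Finset.sum_add_distrib]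
    rw [h3]
    rw [lagrangian, normSq] at h2
    simp only at h2
    linarith
  refine (ENNReal.ofReal_le_ofReal h4).trans ?_
  rw [ENNReal.ofReal_mul (by norm_num), ENNReal.ofReal_div_of_pos two_pos, kineticEnergy,
    ENNReal.ofReal_one, ENNReal.ofReal_ofNat]
  gcongr
  refine (Finset.le_sum_of_subadditive ENNReal.ofReal ENNReal.ofReal_zero.le
    (fun _ _ => ENNReal.ofReal_add_le) _ _).trans ?_
  rw [Finset.mul_sum]
  exact Finset.sum_le_sum fun e _ => ofReal_mul_sub_le_kinetic _ _ _

end Graph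

/-! ### Square-integrable curves in the simplex and integral functionals on them. -/

section Curves

variable {n : ℕ}

/-- The space of square-integrable curves with values in a Euclidean space. -/
abbrev L2Curve (ι : Type*) [Fintype ι] : Type _ :=
  Lp (EuclideanSpace ℝ ι) 2 (volume.restrict (Ioo (0 : ℝ) 1))

/-- The square-integrable curves with values in the probability simplex. -/
def simplexCurves (n : ℕ) : Set (L2Curve (Fin n)) :=
  {x | ∀ᵐ t ∂volume.restrict (Ioo (0 : ℝ) 1), (x t).ofLp ∈ stdSimplex ℝ (Fin n)}

theorem convex_simplexCurves : Convex ℝ (simplexCurves n) := by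
  intro x hx y hy a b ha hb hab
  filter_upwards [hx, hy, Lp.coeFn_add (a • x) (b • y), Lp.coeFn_smul a x, Lp.coeFn_smul b y]
    with t h1 h2 h3 h4 h5
  rw [h3, Pi.add_apply, h4, h5]
  exact convex_stdSimplex ℝ (Fin n) h1 h2 ha hb hab

theorem exists_bound_on_simplex {F : ℝ → (Fin n → ℝ) → ℝ}
    (hF : Continuous fun p : ℝ × (Fin n → ℝ) => F p.1 p.2) :
    ∃ C, ∀ t ∈ Icc (0 : ℝ) 1, ∀ q ∈ stdSimplex ℝ (Fin n), ‖F t q‖ ≤ C := by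
  obtain ⟨C, hC⟩ := (isCompact_Icc.prod (isCompact_stdSimplex ℝ (Fin n))).exists_bound_of_continuousOn
    (s := Icc (0 : ℝ) 1 ×ˢ stdSimplex ℝ (Fin n)) hF.continuousOn
  exact ⟨C, fun t ht q hq => hC (t, q) ⟨ht, hq⟩⟩

theorem aestronglyMeasurable_comp_curve {F : ℝ → (Fin n → ℝ) → ℝ}
    (hF : Continuous fun p : ℝ × (Fin n → ℝ) => F p.1 p.2) (x : L2Curve (Fin n)) :
    AEStronglyMeasurable (fun t => F t (x t).ofLp) (volume.restrict (Ioo (0 : ℝ) 1)) := by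
  have h1 : AEStronglyMeasurable (fun t => (x t).ofLp) (volume.restrict (Ioo (0 : ℝ) 1)) :=
    (PiLp.continuous_ofLp 2 _).comp_aestronglyMeasurable (Lp.aestronglyMeasurable x)
  exact hF.comp_aestronglyMeasurable (aestronglyMeasurable_id.prodMk h1)

theorem memLp_comp_curve {F : ℝ → (Fin n → ℝ) → ℝ}
    (hF : Continuous fun p : ℝ × (Fin n → ℝ) => F p.1 p.2) {x : L2Curve (Fin n)}
    (hx : x ∈ simplexCurves n) (p : ℝ≥0∞) :
    MemLp (fun t => F t (x t).ofLp) p (volume.restrict (Ioo (0 : ℝ) 1)) := by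
  obtain ⟨C, hC⟩ := exists_bound_on_simplex hF
  refine MemLp.of_bound (aestronglyMeasurable_comp_curve hF x) C ?_
  filter_upwards [hx, ae_restrict_mem measurableSet_Ioo] with t h1 h2
  exact hC t (Ioo_subset_Icc_self h2) _ h1

theorem integrable_comp_curve {F : ℝ → (Fin n → ℝ) → ℝ}
    (hF : Continuous fun p : ℝ × (Fin n → ℝ) => F p.1 p.2) {x : L2Curve (Fin n)}
    (hx : x ∈ simplexCurves n) :
    Integrable (fun t => F t (x t).ofLp) (volume.restrict (Ioo (0 : ℝ) 1)) :=
  memLp_one_iff_integrable.1 (memLp_comp_curve hF hx 1)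

theorem norm_le_one_of_mem_simplexCurves {x : L2Curve (Fin n)} (hx : x ∈ simplexCurves n) :
    ‖x‖ ≤ 1 := by
  have h : ∀ᵐ t ∂volume.restrict (Ioo (0 : ℝ) 1), ‖x t‖ ≤ 1 := by
    filter_upwards [hx] with t ht
    rw [EuclideanSpace.norm_eq]
    refine Real.sqrt_le_iff.2 ⟨zero_le_one, ?_⟩
    rw [one_pow]
    refine (Finset.sum_le_sum (g := (x t).ofLp) fun i _ => ?_).trans_eq ht.2
    have h0 := ht.1 i
    have h1 : (x t).ofLp i ≤ 1 :=
      (Finset.single_le_sum (fun j _ => ht.1 j) (Finset.mem_univ i)).trans_eq ht.2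
    rw [Real.norm_eq_abs, sq_abs]
    nlinarith
  have h1 : measureUnivNNReal (volume.restrict (Ioo (0 : ℝ) 1)) = 1 := by
    simp [measureUnivNNReal]
  refine (Lp.norm_le_of_ae_bound zero_le_one h).trans ?_
  simp [h1]

/-- Integral functionals with continuous integrands have closed superlevel sets on the set of
curves in the simplex. -/
theorem isClosed_superlevel {F : ℝ → (Fin n → ℝ) → ℝ}
    (hF : Continuous fun p : ℝ × (Fin n → ℝ) => F p.1 p.2) (c : ℝ) :
    IsClosed {x : L2Curve (Fin n) |
      x ∈ simplexCurves n ∧ c ≤ ∫ t in Ioo (0 : ℝ) 1, F t (x t).ofLp} := by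
  refine IsSeqClosed.isClosed fun u x hu hux => ?_
  -- An L²-convergent sequence has an almost everywhere convergent subsequence; boundedness on the
  -- simplex then allows dominated convergence.
  obtain ⟨φ, -, hφ⟩ := (tendstoInMeasure_of_tendsto_Lp hux).exists_seq_tendsto_ae
  have hae : ∀ᵐ t ∂volume.restrict (Ioo (0 : ℝ) 1),
      Filter.Tendsto (fun k => ((u (φ k)) t).ofLp) Filter.atTop (nhds (x t).ofLp) := by
    filter_upwards [hφ] with t ht
    exact ((PiLp.continuous_ofLp 2 _).tendsto _).comp ht
  have hall : ∀ᵐ t ∂volume.restrict (Ioo (0 : ℝ) 1), ∀ k,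
      ((u (φ k)) t).ofLp ∈ stdSimplex ℝ (Fin n) := ae_all_iff.2 fun k => (hu (φ k)).1
  have hx : x ∈ simplexCurves n := by
    filter_upwards [hae, hall] with t h1 h2
    exact (isClosed_stdSimplex ℝ (Fin n)).mem_of_tendsto h1 (Filter.Eventually.of_forall h2)
  refine ⟨hx, ?_⟩
  obtain ⟨C, hC⟩ := exists_bound_on_simplex hF
  have hlim : Filter.Tendsto (fun k => ∫ t in Ioo (0 : ℝ) 1, F t ((u (φ k)) t).ofLp) Filter.atTop
      (nhds (∫ t in Ioo (0 : ℝ) 1, F t (x t).ofLp)) := by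
    refine tendsto_integral_of_dominated_convergence (fun _ => C)
      (fun k => aestronglyMeasurable_comp_curve hF _) (integrable_const _) (fun k => ?_) ?_
    · filter_upwards [hall, ae_restrict_mem measurableSet_Ioo] with t h1 h2
      exact hC t (Ioo_subset_Icc_self h2) _ (h1 k)
    · filter_upwards [hae] with t ht
      have h1 : Continuous fun q : Fin n → ℝ => F t q :=
        hF.comp (continuous_const.prodMk continuous_id)
      exact (h1.tendsto _).comp ht
  exact ge_of_tendsto' hlim fun k => (hu (φ k)).2

theorem concaveOn_integral_comp_curve {F : ℝ → (Fin n → ℝ) → ℝ}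
    (hF : Continuous fun p : ℝ × (Fin n → ℝ) => F p.1 p.2)
    (hconc : ∀ t, ConcaveOn ℝ (stdSimplex ℝ (Fin n)) (F t)) :
    ConcaveOn ℝ (simplexCurves n) fun x => ∫ t in Ioo (0 : ℝ) 1, F t (x t).ofLp := by
  refine ⟨convex_simplexCurves, fun x hx y hy a b ha hb hab => ?_⟩
  have hxi := integrable_comp_curve hF hx
  have hyi := integrable_comp_curve hF hy
  simp only [smul_eq_mul]
  rw [← integral_const_mul, ← integral_const_mul,
    ← integral_add (hxi.const_mul a) (hyi.const_mul b)]
  refine integral_mono_ae ((hxi.const_mul a).add (hyi.const_mul b))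
    (integrable_comp_curve hF (convex_simplexCurves hx hy ha hb hab)) ?_
  filter_upwards [hx, hy, Lp.coeFn_add (a • x) (b • y), Lp.coeFn_smul a x, Lp.coeFn_smul b y]
    with t h1 h2 h3 h4 h5
  rw [h3, Pi.add_apply, h4, h5]
  exact (hconc t).2 h1 h2 ha hb hab

/-- Measurable selection of almost maximizing curves. -/
theorem exists_curve_integral_ge (hn : (stdSimplex ℝ (Fin n)).Nonempty)
    {F : ℝ → (Fin n → ℝ) → ℝ} (hF : Continuous fun p : ℝ × (Fin n → ℝ) => F p.1 p.2)
    {ε : ℝ} (hε : 0 < ε) :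
    ∃ x ∈ simplexCurves n,
      ∫ t in Ioo (0 : ℝ) 1, sSup (F t '' stdSimplex ℝ (Fin n)) ≤
        (∫ t in Ioo (0 : ℝ) 1, F t (x t).ofLp) + ε := by
  classical
  have hS : Continuous fun t => sSup (F t '' stdSimplex ℝ (Fin n)) :=
    (isCompact_stdSimplex ℝ (Fin n)).continuous_sSup hF
  have hFt : ∀ t, Continuous (F t) := fun t => hF.comp (continuous_const.prodMk continuous_id)
  have : Nonempty (stdSimplex ℝ (Fin n)) := hn.to_subtype
  -- At each time the first `ε`-maximizer in a fixed dense sequence is chosen; taking the least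
  -- index makes the choice measurable.
  let q : ℕ → stdSimplex ℝ (Fin n) := TopologicalSpace.denseSeq _
  have hq : ∀ t, ∃ k, sSup (F t '' stdSimplex ℝ (Fin n)) - ε < F t (q k) := by
    intro t
    obtain ⟨_, ⟨p, hp, rfl⟩, hlt⟩ := exists_lt_of_lt_csSup (hn.image (F t))
      (sub_lt_self (sSup (F t '' stdSimplex ℝ (Fin n))) hε)
    obtain ⟨k, hk⟩ := (TopologicalSpace.denseRange_denseSeq
      (stdSimplex ℝ (Fin n))).exists_mem_open
      (isOpen_lt continuous_const ((hFt t).comp continuous_subtype_val)) ⟨⟨p, hp⟩, hlt⟩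
    exact ⟨k, hk⟩
  let N : ℝ → ℕ := fun t => Nat.find (hq t)
  have hN : Measurable N := measurable_find hq fun k =>
    measurableSet_lt (hS.measurable.sub_const ε)
      (hF.comp (continuous_id.prodMk continuous_const)).measurable
  have hm : Measurable fun t => WithLp.toLp 2 (q (N t) : Fin n → ℝ) :=
    (measurable_from_nat (f := fun k => WithLp.toLp 2 (q k : Fin n → ℝ))).comp hN
  have hb : ∀ i, ∀ p ∈ stdSimplex ℝ (Fin n), |p i| ≤ 1 := fun i p hp => by
    rw [abs_of_nonneg (hp.1 i), ← hp.2]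
    exact Finset.single_le_sum (fun j _ => hp.1 j) (Finset.mem_univ i)
  have hmem : MemLp (fun t => WithLp.toLp 2 (q (N t) : Fin n → ℝ)) 2
      (volume.restrict (Ioo (0 : ℝ) 1)) := by
    refine MemLp.of_bound hm.aestronglyMeasurable (√(∑ _i : Fin n, 1))
      (Filter.Eventually.of_forall fun t => ?_)
    rw [EuclideanSpace.norm_eq]
    refine Real.sqrt_le_sqrt (Finset.sum_le_sum fun i _ => ?_)
    have := hb i _ (q (N t)).2
    rw [Real.norm_eq_abs]
    exact pow_le_one₀ (abs_nonneg _) this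
  obtain ⟨x, hcoe⟩ : ∃ x : L2Curve (Fin n), x =ᵐ[volume.restrict (Ioo (0 : ℝ) 1)]
      fun t => WithLp.toLp 2 (q (N t) : Fin n → ℝ) := ⟨hmem.toLp, hmem.coeFn_toLp⟩
  have hx : x ∈ simplexCurves n := by
    filter_upwards [hcoe] with t ht
    rw [ht]
    exact (q (N t)).2
  refine ⟨x, hx, ?_⟩
  have hSi : Integrable (fun t => sSup (F t '' stdSimplex ℝ (Fin n)))
      (volume.restrict (Ioo (0 : ℝ) 1)) :=
    MemLp.integrable one_le_two (memL2_of_continuous hS)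
  have hFi := integrable_comp_curve hF hx
  have hle : ∫ t in Ioo (0 : ℝ) 1, sSup (F t '' stdSimplex ℝ (Fin n)) ≤
      ∫ t in Ioo (0 : ℝ) 1, (F t (x t).ofLp + ε) := by
    refine integral_mono_ae hSi (hFi.add (integrable_const _)) ?_
    filter_upwards [hcoe] with t ht
    rw [ht]
    have := Nat.find_spec (hq t)
    change sSup (F t '' stdSimplex ℝ (Fin n)) ≤ F t (q (N t)) + ε
    linarith
  rw [integral_add hFi (integrable_const _)] at hle
  simpa [Measure.real] using hle

end Curves

/-! ### The dual problem on C¹ curves and the minimax step. -/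

section Duality

variable {n : ℕ} {G : WeightedGraph n} {g : ℝ → ℝ → ℝ}

/-- The space of continuously differentiable curves in `ℝⁿ`. -/
def c1Curves (n : ℕ) : Submodule ℝ (ℝ → Fin n → ℝ) where
  carrier := {l | ∀ i, ContDiff ℝ 1 fun t => l t i}
  add_mem' h1 h2 i := (h1 i).add (h2 i)
  zero_mem' _ := contDiff_const
  smul_mem' _ _ h i := contDiff_const.mul (h i)

/-- The componentwise derivative of a curve. -/
noncomputable def velocity (l : ℝ → Fin n → ℝ) (t : ℝ) : Fin n → ℝ :=
  fun i => deriv (fun s => l s i) t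

/-- The boundary term of the dual problem. -/
def boundaryTerm (ρ0 ρ1 : Fin n → ℝ) (l : ℝ → Fin n → ℝ) : ℝ :=
  ∑ i, l 1 i * ρ1 i - ∑ i, l 0 i * ρ0 i

theorem velocity_add {l k : ℝ → Fin n → ℝ} (hl : l ∈ c1Curves n) (hk : k ∈ c1Curves n) (t : ℝ) :
    velocity (l + k) t = velocity l t + velocity k t :=
  funext fun i => deriv_add ((hl i).differentiable one_ne_zero t)
    ((hk i).differentiable one_ne_zero t)

theorem velocity_smul (c : ℝ) {l : ℝ → Fin n → ℝ} (hl : l ∈ c1Curves n) (t : ℝ) :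
    velocity (c • l) t = c • velocity l t :=
  funext fun i => deriv_const_mul c ((hl i).differentiable one_ne_zero t)

theorem continuous_velocity {l : ℝ → Fin n → ℝ} (hl : l ∈ c1Curves n) : Continuous (velocity l) :=
  continuous_pi fun i => (hl i).continuous_deriv le_rfl

theorem continuous_of_mem_c1Curves {l : ℝ → Fin n → ℝ} (hl : l ∈ c1Curves n) : Continuous l :=
  continuous_pi fun i => (hl i).continuous

theorem boundaryTerm_add (ρ0 ρ1 : Fin n → ℝ) (l k : ℝ → Fin n → ℝ) :
    boundaryTerm ρ0 ρ1 (l + k) = boundaryTerm ρ0 ρ1 l + boundaryTerm ρ0 ρ1 k := by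
  simp only [boundaryTerm, Pi.add_apply, add_mul, Finset.sum_add_distrib]
  ring

theorem boundaryTerm_smul (ρ0 ρ1 : Fin n → ℝ) (c : ℝ) (l : ℝ → Fin n → ℝ) :
    boundaryTerm ρ0 ρ1 (c • l) = c * boundaryTerm ρ0 ρ1 l := by
  simp only [boundaryTerm, Pi.smul_apply, smul_eq_mul, mul_assoc, ← Finset.mul_sum, mul_sub]

theorem grad_add (φ ψ : Fin n → ℝ) : grad G (φ + ψ) = grad G φ + grad G ψ := by
  ext i j
  simp only [grad, Matrix.add_apply, Pi.add_apply]
  split_ifs <;> ring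

theorem grad_smul (c : ℝ) (φ : Fin n → ℝ) : grad G (c • φ) = c • grad G φ := by
  ext i j
  simp only [grad, Matrix.smul_apply, Pi.smul_apply, smul_eq_mul]
  split_ifs <;> ring

theorem grad_sub_const (φ : Fin n → ℝ) (c : ℝ) : grad G (fun i => φ i - c) = grad G φ := by
  ext i j
  simp only [grad, sub_sub_sub_cancel_right]

theorem continuous_grad : Continuous (grad G) := by
  refine continuous_matrix fun i j => ?_
  unfold grad
  split_ifs <;> fun_prop

theorem IsMobility.continuous_lagrangian_curve (hg : IsMobility g) {l : ℝ → Fin n → ℝ}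
    (hl : l ∈ c1Curves n) : Continuous fun p : ℝ × (Fin n → ℝ) =>
      lagrangian G (extendQuadrant g) (velocity l p.1) (grad G (l p.1)) p.2 := by
  have h : Continuous fun p : ℝ × (Fin n → ℝ) => ((velocity l p.1, grad G (l p.1)), p.2) :=
    (((continuous_velocity hl).comp continuous_fst).prodMk
      (continuous_grad.comp ((continuous_of_mem_c1Curves hl).comp continuous_fst))).prodMk
      continuous_snd
  exact (hg.continuous_lagrangian (G := G)).comp h

theorem IsMobility.concaveOn_lagrangian (hg : IsMobility g) (a : Fin n → ℝ)
    (b : Matrix (Fin n) (Fin n) ℝ) :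
    ConcaveOn ℝ (stdSimplex ℝ (Fin n)) (lagrangian G (extendQuadrant g) a b) := by
  refine ⟨convex_stdSimplex ℝ (Fin n), fun ρ hρ σ hσ c d hc hd hcd => ?_⟩
  have hτ := convex_stdSimplex ℝ (Fin n) hρ hσ hc hd hcd
  rw [lagrangian_extendQuadrant hρ.1, lagrangian_extendQuadrant hσ.1,
    lagrangian_extendQuadrant hτ.1]
  have h1 : ∑ i, a i * (c • ρ + d • σ) i = c * ∑ i, a i * ρ i + d * ∑ i, a i * σ i := by
    rw [Finset.mul_sum, Finset.mul_sum, ← Finset.sum_add_distrib]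
    refine Finset.sum_congr rfl fun i _ => ?_
    simp only [Pi.add_apply, Pi.smul_apply, smul_eq_mul]
    ring
  have h2 : c * normSq G g ρ b + d * normSq G g σ b ≤ normSq G g (c • ρ + d • σ) b := by
    have : c * normSq G g ρ b + d * normSq G g σ b = 1 / 2 * ∑ e ∈ G.edges,
        b e.1 e.2 ^ 2 * (c * g (ρ e.1) (ρ e.2) + d * g (σ e.1) (σ e.2)) := by
      simp only [normSq, mul_add, Finset.sum_add_distrib, Finset.mul_sum]
      congr 1 <;> exact Finset.sum_congr rfl fun e _ => by ring
    rw [this, normSq]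
    refine mul_le_mul_of_nonneg_left (Finset.sum_le_sum fun e _ =>
      mul_le_mul_of_nonneg_left ?_ (sq_nonneg _)) (by norm_num)
    exact hg.concaveOn.2 (x := (ρ e.1, ρ e.2)) (y := (σ e.1, σ e.2))
      ⟨hρ.1 _, hρ.1 _⟩ ⟨hσ.1 _, hσ.1 _⟩ hc hd hcd
  simp only [lagrangian, h1, smul_eq_mul]
  linarith

/-- Convexity in `(a, b)`, from squares with nonnegative weights, supplies the concavity of the
minimax functional in the test curve. -/
theorem IsMobility.lagrangian_combination_le (hg : IsMobility g) (ρ : Fin n → ℝ)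
    (a a' : Fin n → ℝ) (b b' : Matrix (Fin n) (Fin n) ℝ) {c d : ℝ} (hc : 0 ≤ c) (hd : 0 ≤ d)
    (hcd : c + d = 1) :
    lagrangian G (extendQuadrant g) (c • a + d • a') (c • b + d • b') ρ ≤
      c * lagrangian G (extendQuadrant g) a b ρ + d * lagrangian G (extendQuadrant g) a' b' ρ := by
  have h1 : ∑ i, (c • a + d • a') i * ρ i = c * ∑ i, a i * ρ i + d * ∑ i, a' i * ρ i := by
    rw [Finset.mul_sum, Finset.mul_sum, ← Finset.sum_add_distrib]
    refine Finset.sum_congr rfl fun i _ => ?_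
    simp only [Pi.add_apply, Pi.smul_apply, smul_eq_mul]
    ring
  have h2 : normSq G (extendQuadrant g) ρ (c • b + d • b') ≤
      c * normSq G (extendQuadrant g) ρ b + d * normSq G (extendQuadrant g) ρ b' := by
    have : c * normSq G (extendQuadrant g) ρ b + d * normSq G (extendQuadrant g) ρ b' =
        1 / 2 * ∑ e ∈ G.edges,
          (c * b e.1 e.2 ^ 2 + d * b' e.1 e.2 ^ 2) * extendQuadrant g (ρ e.1) (ρ e.2) := by
      simp only [normSq, add_mul, mul_add, Finset.sum_add_distrib, Finset.mul_sum]
      congr 1 <;> exact Finset.sum_congr rfl fun e _ => by ring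
    rw [this, normSq]
    refine mul_le_mul_of_nonneg_left (Finset.sum_le_sum fun e _ =>
      mul_le_mul_of_nonneg_right ?_ (hg.extendQuadrant_nonneg _ _)) (by norm_num)
    exact (even_two.convexOn_pow (𝕜 := ℝ)).2 (mem_univ (b e.1 e.2)) (mem_univ (b' e.1 e.2))
      hc hd hcd
  simp only [lagrangian, h1]
  linarith

/-- Every continuously differentiable curve can be corrected by a time dependent constant to a
solution of the Hamilton-Jacobi equation. -/
theorem IsMobility.boundaryTerm_sub_integral_mem_dualValues (hg : IsMobility g)
    {ρ0 ρ1 : Fin n → ℝ} (hρ1 : ρ1 ∈ stdSimplex ℝ (Fin n)) {l : ℝ → Fin n → ℝ}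
    (hl : l ∈ c1Curves n) :
    boundaryTerm ρ0 ρ1 l -
      ∫ t in Ioo (0 : ℝ) 1, hamiltonian G g (velocity l t) (grad G (l t)) ∈
        dualValues G g ρ0 ρ1 := by
  set h : ℝ → ℝ := fun t => hamiltonian G g (velocity l t) (grad G (l t)) with hh
  have hc : Continuous h := (hg.continuous_hamiltonian (G := G)).comp
    ((continuous_velocity hl).prodMk (continuous_grad.comp (continuous_of_mem_c1Curves hl)))
  have hv : ∀ i, Continuous fun t => velocity l t i := fun i =>
    (continuous_apply i).comp (continuous_velocity hl)
  refine ⟨fun t i => l t i - ∫ x in (0 : ℝ)..t, h x, fun t i => velocity l t i - h t,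
    fun i => ?_, ?_, ?_⟩
  · refine hasH1Deriv_of_primitive (memL2_of_continuous ((hv i).sub hc)) fun t _ => ?_
    rw [intervalIntegral.integral_sub ((hv i).intervalIntegrable _ _) (hc.intervalIntegrable _ _)]
    beta_reduce
    rw [intervalIntegral.integral_same, eq_add_integral_deriv_of_contDiff (hl i) 0 t]
    simp only [velocity]
    ring
  · refine Filter.Eventually.of_forall fun t => ?_
    simp only [grad_sub_const, hg.hamiltonian_sub_const, hh, sub_self]
  · rw [setIntegral_Ioo_eq_intervalIntegral]
    simp only [boundaryTerm, sub_mul, Finset.sum_sub_distrib, ← Finset.mul_sum, hρ1.2,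
      intervalIntegral.integral_same]
    ring

/-- The minimax step: an optimal curve in the simplex. -/
theorem IsMobility.exists_optimal_curve (hg : IsMobility g) {ρ0 ρ1 : Fin n → ℝ}
    (hρ1 : ρ1 ∈ stdSimplex ℝ (Fin n)) {D : ℝ} (hD : D ∈ upperBounds (dualValues G g ρ0 ρ1)) :
    ∃ x ∈ simplexCurves n, ∀ l ∈ c1Curves n, boundaryTerm ρ0 ρ1 l -
      ∫ t in Ioo (0 : ℝ) 1,
        lagrangian G (extendQuadrant g) (velocity l t) (grad G (l t)) (x t).ofLp ≤ D := by
  let F : c1Curves n → ℝ → (Fin n → ℝ) → ℝ := fun l t q =>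
    lagrangian G (extendQuadrant g) (velocity l t) (grad G (l.1 t)) q
  have hcont : ∀ l, Continuous fun p : ℝ × (Fin n → ℝ) => F l p.1 p.2 :=
    fun l => hg.continuous_lagrangian_curve (G := G) l.2
  have hsel : ∀ l : c1Curves n, ∀ ε > 0, ∃ x ∈ simplexCurves n,
      boundaryTerm ρ0 ρ1 l - ∫ t in Ioo (0 : ℝ) 1, F l t (x t).ofLp ≤ D + ε := by
    intro l ε hε
    obtain ⟨x, hx, h⟩ := exists_curve_integral_ge G.nonempty_stdSimplex (hcont l) hε
    refine ⟨x, hx, ?_⟩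
    have h2 := hD (hg.boundaryTerm_sub_integral_mem_dualValues (ρ0 := ρ0) hρ1 l.2)
    simp only [hamiltonian_eq_sSup] at h2
    change ∫ t in Ioo (0 : ℝ) 1, sSup (lagrangian G (extendQuadrant g) (velocity l t)
      (grad G (l.1 t)) '' stdSimplex ℝ (Fin n)) ≤ _ at h
    linarith
  suffices h : ∃ x ∈ simplexCurves n, ∀ l : c1Curves n,
      boundaryTerm ρ0 ρ1 l - ∫ t in Ioo (0 : ℝ) 1, F l t (x t).ofLp ≤ D by
    obtain ⟨x, hx, h⟩ := h
    exact ⟨x, hx, fun l hl => h ⟨l, hl⟩⟩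
  refine exists_forall_le_of_minimax (K := simplexCurves n) (R := 1)
    (L := fun x (l : c1Curves n) => boundaryTerm ρ0 ρ1 l - ∫ t in Ioo (0 : ℝ) 1, F l t (x t).ofLp)
    (let ⟨x, hx, _⟩ := hsel 0 1 one_pos; ⟨x, hx⟩)
    (fun x hx => norm_le_one_of_mem_simplexCurves hx) (fun l => ?_) (fun l c => ?_)
    (fun x hx => ?_) hsel
  · exact (convexOn_const _ convex_simplexCurves).sub
      (concaveOn_integral_comp_curve (hcont l) fun t => hg.concaveOn_lagrangian _ _)
  · convert isClosed_superlevel (hcont l) (boundaryTerm ρ0 ρ1 l - c) using 4 with x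
    exact sub_le_comm
  · refine ⟨convex_univ, fun l _ k _ c d hc hd hcd => ?_⟩
    have hi := fun l => integrable_comp_curve (hcont l) hx
    have hB : boundaryTerm ρ0 ρ1 (c • l + d • k : c1Curves n) =
        c * boundaryTerm ρ0 ρ1 l + d * boundaryTerm ρ0 ρ1 k := by
      rw [Submodule.coe_add, Submodule.coe_smul, Submodule.coe_smul, boundaryTerm_add,
        boundaryTerm_smul, boundaryTerm_smul]
    have hint : ∫ t in Ioo (0 : ℝ) 1, F (c • l + d • k) t (x t).ofLp ≤
        c * (∫ t in Ioo (0 : ℝ) 1, F l t (x t).ofLp) +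
          d * ∫ t in Ioo (0 : ℝ) 1, F k t (x t).ofLp := by
      rw [← integral_const_mul c, ← integral_const_mul d,
        ← integral_add ((hi l).const_mul c) ((hi k).const_mul d)]
      refine integral_mono (hi _) (((hi l).const_mul c).add ((hi k).const_mul d)) fun t => ?_
      have hv : velocity (c • l + d • k : c1Curves n).1 t =
          c • velocity l.1 t + d • velocity k.1 t := by
        rw [Submodule.coe_add, Submodule.coe_smul, Submodule.coe_smul,
          velocity_add ((c1Curves n).smul_mem c l.2) ((c1Curves n).smul_mem d k.2),
          velocity_smul c l.2, velocity_smul d k.2]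
      have hgr : grad G ((c • l + d • k : c1Curves n).1 t) =
          c • grad G (l.1 t) + d • grad G (k.1 t) := by
        rw [Submodule.coe_add, Submodule.coe_smul, Submodule.coe_smul, Pi.add_apply, grad_add,
          Pi.smul_apply, Pi.smul_apply, grad_smul, grad_smul]
      simp only [F, hv, hgr]
      exact hg.lagrangian_combination_le _ _ _ _ _ hc hd hcd
    simp only [smul_eq_mul]
    rw [hB]
    linarith

end Duality

/-! ### Recovering an admissible pair from the optimal curve. -/

section Recovery

variable {n : ℕ} {G : WeightedGraph n} {g : ℝ → ℝ → ℝ}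

/-- The discrete gradient of `φ`, weighted with the square root of the mobility at `ρ`. -/
noncomputable def weightedGrad (G : WeightedGraph n) (g : ℝ → ℝ → ℝ) (φ ρ : Fin n → ℝ)
    (e : Fin n × Fin n) : ℝ :=
  √(extendQuadrant g (ρ e.1) (ρ e.2) / 2) * grad G φ e.1 e.2

theorem grad_eq_zero_of_notMem_edges (φ : Fin n → ℝ) {e : Fin n × Fin n} (he : e ∉ G.edges) :
    grad G φ e.1 e.2 = 0 := by
  rw [grad, if_neg fun h => he (mem_edges.2 h)]

/-- The factor `√(g/2)` is chosen so that the plain Euclidean norm over ordered pairs reproduces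
`‖∇φ‖²_ρ`. -/
theorem IsMobility.sum_weightedGrad_sq (hg : IsMobility g) (φ ρ : Fin n → ℝ) :
    ∑ e, weightedGrad G g φ ρ e * weightedGrad G g φ ρ e =
      normSq G (extendQuadrant g) ρ (grad G φ) := by
  rw [normSq, Finset.mul_sum, ← Finset.sum_subset (Finset.subset_univ G.edges)]
  · refine Finset.sum_congr rfl fun e _ => ?_
    have h := Real.mul_self_sqrt (div_nonneg (hg.extendQuadrant_nonneg (ρ e.1) (ρ e.2)) zero_le_two)
    rw [weightedGrad, mul_mul_mul_comm, h]
    ring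
  · intro e _ he
    rw [weightedGrad, grad_eq_zero_of_notMem_edges φ he]
    ring

theorem IsMobility.continuous_mobilityFactor (hg : IsMobility g) (i j : Fin n) :
    Continuous fun p : ℝ × (Fin n → ℝ) => √(extendQuadrant g (p.2 i) (p.2 j) / 2) := by
  have h : Continuous fun p : ℝ × (Fin n → ℝ) => (p.2 i, p.2 j) := by fun_prop
  exact ((hg.continuous_extendQuadrant.comp h).div_const 2).sqrt

theorem IsMobility.continuous_weightedGrad (hg : IsMobility g) {l : ℝ → Fin n → ℝ}
    (hl : l ∈ c1Curves n) (e : Fin n × Fin n) :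
    Continuous fun p : ℝ × (Fin n → ℝ) => weightedGrad G g (l p.1) p.2 e :=
  (hg.continuous_mobilityFactor e.1 e.2).mul
    ((continuous_grad.comp ((continuous_of_mem_c1Curves hl).comp continuous_fst)).matrix_elem _ _)

theorem IsMobility.memLp_weightedGrad (hg : IsMobility g) {x : L2Curve (Fin n)}
    (hx : x ∈ simplexCurves n) {l : ℝ → Fin n → ℝ} (hl : l ∈ c1Curves n) :
    MemLp (fun t => WithLp.toLp 2 (weightedGrad G g (l t) (x t).ofLp)) 2
      (volume.restrict (Ioo (0 : ℝ) 1)) :=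
  memLp_piLp_iff.2 fun e =>
    memLp_comp_curve (F := fun t q => weightedGrad G g (l t) q e) (hg.continuous_weightedGrad hl e)
      hx 2

/-- The weighted discrete gradient as a linear map on curves. -/
noncomputable def weightedGradMap (G : WeightedGraph n) (hg : IsMobility g) {x : L2Curve (Fin n)}
    (hx : x ∈ simplexCurves n) : c1Curves n →ₗ[ℝ] L2Curve (Fin n × Fin n) where
  toFun l := (hg.memLp_weightedGrad (G := G) hx l.2).toLp
  map_add' l k := by
    rw [← MemLp.toLp_add]
    refine MemLp.toLp_congr _ _ (Filter.Eventually.of_forall fun t => ?_)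
    ext e
    simp [weightedGrad, grad_add, mul_add]
  map_smul' c l := by
    rw [RingHom.id_apply, ← MemLp.toLp_const_smul]
    refine MemLp.toLp_congr _ _ (Filter.Eventually.of_forall fun t => ?_)
    ext e
    simp [weightedGrad, grad_smul, mul_left_comm]

theorem inner_weightedGradMap (hg : IsMobility g) {x : L2Curve (Fin n)}
    (hx : x ∈ simplexCurves n) (w : L2Curve (Fin n × Fin n)) (l : c1Curves n) :
    inner ℝ w (weightedGradMap G hg hx l) =
      ∫ t in Ioo (0 : ℝ) 1, ∑ e, w t e * weightedGrad G g (l.1 t) (x t).ofLp e := by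
  rw [L2.inner_def]
  refine integral_congr_ae ?_
  filter_upwards [(hg.memLp_weightedGrad (G := G) hx l.2).coeFn_toLp] with t ht
  change inner ℝ (w t) ((hg.memLp_weightedGrad (G := G) hx l.2).toLp _ t) = _
  rw [ht, PiLp.inner_apply]
  exact Finset.sum_congr rfl fun e _ => mul_comm _ _

theorem norm_sq_weightedGradMap (hg : IsMobility g) {x : L2Curve (Fin n)}
    (hx : x ∈ simplexCurves n) (l : c1Curves n) :
    ‖weightedGradMap G hg hx l‖ ^ 2 =
      ∫ t in Ioo (0 : ℝ) 1, normSq G (extendQuadrant g) (x t).ofLp (grad G (l.1 t)) := by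
  rw [← real_inner_self_eq_norm_sq, inner_weightedGradMap]
  refine integral_congr_ae ?_
  filter_upwards [(hg.memLp_weightedGrad (G := G) hx l.2).coeFn_toLp] with t ht
  rw [← hg.sum_weightedGrad_sq]
  change ∑ e, ((hg.memLp_weightedGrad (G := G) hx l.2).toLp _ t).ofLp e * _ = _
  rw [ht]

theorem continuous_sum_velocity_mul {l : ℝ → Fin n → ℝ} (hl : l ∈ c1Curves n) :
    Continuous fun p : ℝ × (Fin n → ℝ) => ∑ i, velocity l p.1 i * p.2 i := by
  refine continuous_finsetSum _ fun i _ => ?_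
  exact (((continuous_apply i).comp (continuous_velocity hl)).comp continuous_fst).mul
    ((continuous_apply i).comp continuous_snd)

/-- The defect of a curve in the continuity equation without flux, as a linear functional. -/
noncomputable def defect (ρ0 ρ1 : Fin n → ℝ) {x : L2Curve (Fin n)} (hx : x ∈ simplexCurves n) :
    c1Curves n →ₗ[ℝ] ℝ where
  toFun l := boundaryTerm ρ0 ρ1 l - ∫ t in Ioo (0 : ℝ) 1, ∑ i, velocity l t i * (x t).ofLp i
  map_add' l k := by
    have hi := fun l : c1Curves n => integrable_comp_curve
      (F := fun t q => ∑ i, velocity l.1 t i * q i) (continuous_sum_velocity_mul l.2) hx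
    have h : ∫ t in Ioo (0 : ℝ) 1, ∑ i, velocity (l + k : c1Curves n).1 t i * (x t).ofLp i =
        (∫ t in Ioo (0 : ℝ) 1, ∑ i, velocity l.1 t i * (x t).ofLp i) +
          ∫ t in Ioo (0 : ℝ) 1, ∑ i, velocity k.1 t i * (x t).ofLp i := by
      rw [← integral_add (hi l) (hi k)]
      congr 1
      ext t
      rw [Submodule.coe_add, velocity_add l.2 k.2, ← Finset.sum_add_distrib]
      simp only [Pi.add_apply, add_mul]
    rw [h, Submodule.coe_add, boundaryTerm_add]
    ring
  map_smul' c l := by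
    have h : ∫ t in Ioo (0 : ℝ) 1, ∑ i, velocity (c • l : c1Curves n).1 t i * (x t).ofLp i =
        c * ∫ t in Ioo (0 : ℝ) 1, ∑ i, velocity l.1 t i * (x t).ofLp i := by
      rw [← integral_const_mul]
      congr 1
      ext t
      rw [Submodule.coe_smul, velocity_smul c l.2, Finset.mul_sum]
      simp only [Pi.smul_apply, smul_eq_mul, mul_assoc]
    rw [h, Submodule.coe_smul, boundaryTerm_smul, RingHom.id_apply, smul_eq_mul]
    ring

theorem defect_apply (ρ0 ρ1 : Fin n → ℝ) {x : L2Curve (Fin n)} (hx : x ∈ simplexCurves n)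
    (l : c1Curves n) : defect ρ0 ρ1 hx l = boundaryTerm ρ0 ρ1 l -
      ∫ t in Ioo (0 : ℝ) 1, ∑ i, velocity l.1 t i * (x t).ofLp i := rfl

/-- The momentum field determined by a density and a field on the ordered edges. -/
noncomputable def momentum (G : WeightedGraph n) (g : ℝ → ℝ → ℝ) (ρ : Fin n → ℝ)
    (w : Fin n × Fin n → ℝ) : Matrix (Fin n) (Fin n) ℝ :=
  open Classical in fun i j =>
    if G.graph.Adj i j then √(extendQuadrant g (ρ i) (ρ j) / 2) * (w (i, j) - w (j, i)) else 0

theorem IsMobility.extendQuadrant_symm (hg : IsMobility g) (r s : ℝ) :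
    extendQuadrant g r s = extendQuadrant g s r :=
  hg.symm _ _ (le_max_right _ _) (le_max_right _ _)

theorem IsMobility.momentum_transpose (hg : IsMobility g) (ρ : Fin n → ℝ)
    (w : Fin n × Fin n → ℝ) : (momentum G g ρ w).transpose = -momentum G g ρ w := by
  ext i j
  rw [Matrix.transpose_apply, Matrix.neg_apply, momentum, momentum, G.graph.adj_comm j i,
    hg.extendQuadrant_symm (ρ j)]
  split_ifs <;> ring

/-- The field `w` need not be skew, but the weighted gradient is, so only the skew part of `w`
enters the pairing. This identity fixes the form of `momentum`. -/
theorem IsMobility.sum_mul_divergence_momentum (hg : IsMobility g) (φ ρ : Fin n → ℝ)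
    (w : Fin n × Fin n → ℝ) :
    ∑ i, φ i * -divergence G (momentum G g ρ w) i = ∑ e, w e * weightedGrad G g φ ρ e := by
  rw [sum_mul_divergence (hg.momentum_transpose ρ w),
    ← Finset.sum_subset (Finset.subset_univ G.edges)
      (fun e _ he => by rw [weightedGrad, grad_eq_zero_of_notMem_edges φ he]; ring)]
  have h := sum_edges_swap (G := G) fun i j => w (i, j) * weightedGrad G g φ ρ (i, j)
  have h2 : ∑ e ∈ G.edges, momentum G g ρ w e.1 e.2 * grad G φ e.1 e.2 =
      ∑ e ∈ G.edges, w (e.1, e.2) * weightedGrad G g φ ρ (e.1, e.2) +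
      ∑ e ∈ G.edges, w (e.2, e.1) * weightedGrad G g φ ρ (e.2, e.1) := by
    rw [← Finset.sum_add_distrib]
    refine Finset.sum_congr rfl fun e he => ?_
    rw [momentum, if_pos (mem_edges.1 he), weightedGrad, weightedGrad,
      hg.extendQuadrant_symm (ρ e.2), grad_skew G φ e.1 e.2]
    ring
  rw [h2, h]
  simp only [Prod.mk.eta]
  ring

/-- Where the mobility vanishes so does the momentum, hence the cost is zero; elsewhere the mobility
cancels and `(u - v)²/2 ≤ u² + v²` applies. -/
theorem IsMobility.kineticEnergy_momentum_le (hg : IsMobility g) {ρ : Fin n → ℝ}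
    (hρ : ∀ i, 0 ≤ ρ i) (w : Fin n × Fin n → ℝ) :
    kineticEnergy G g ρ (momentum G g ρ w) ≤ ENNReal.ofReal (∑ e, w e ^ 2) := by
  have hk : ∀ e ∈ G.edges, kinetic (g (ρ e.1) (ρ e.2)) (momentum G g ρ w e.1 e.2) ≤
      ENNReal.ofReal (w (e.1, e.2) ^ 2 + w (e.2, e.1) ^ 2) := by
    intro e he
    rw [momentum, if_pos (mem_edges.1 he), extendQuadrant_of_nonneg (hρ _) (hρ _)]
    have hq := hg.nonneg _ _ (hρ e.1) (hρ e.2)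
    set q := g (ρ e.1) (ρ e.2)
    rcases hq.eq_or_lt with h0 | h0
    · simp [← h0, kinetic]
    · rw [kinetic, if_pos h0]
      refine ENNReal.ofReal_le_ofReal ?_
      rw [mul_pow, Real.sq_sqrt (by positivity)]
      have : q / 2 * (w (e.1, e.2) - w (e.2, e.1)) ^ 2 / q =
          (w (e.1, e.2) - w (e.2, e.1)) ^ 2 / 2 := by field_simp
      rw [this]
      nlinarith [sq_nonneg (w (e.1, e.2) + w (e.2, e.1))]
  have hsum : 1 / 2 * ∑ e ∈ G.edges, (w (e.1, e.2) ^ 2 + w (e.2, e.1) ^ 2) ≤ ∑ e, w e ^ 2 := by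
    rw [Finset.sum_add_distrib, sum_edges_swap fun i j => w (i, j) ^ 2]
    have := Finset.sum_le_sum_of_subset_of_nonneg (Finset.subset_univ G.edges)
      (f := fun e => w e ^ 2) fun _ _ _ => sq_nonneg _
    simp only [Prod.mk.eta]
    linarith
  refine le_trans ?_ (ENNReal.ofReal_le_ofReal hsum)
  rw [ENNReal.ofReal_mul (by norm_num), ENNReal.ofReal_div_of_pos two_pos, kineticEnergy,
    ENNReal.ofReal_one, ENNReal.ofReal_ofNat,
    ENNReal.ofReal_sum_of_nonneg fun _ _ => add_nonneg (sq_nonneg _) (sq_nonneg _)]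
  gcongr with e he
  exact hk e he

theorem IsMobility.memL2_momentum (hg : IsMobility g) {x : L2Curve (Fin n)}
    (hx : x ∈ simplexCurves n) (w : L2Curve (Fin n × Fin n)) (i j : Fin n) :
    MemL2 fun t => momentum G g (x t).ofLp (w t).ofLp i j := by
  have hw : ∀ e, MemL2 fun t => (w t).ofLp e := fun e => memLp_piLp_iff.1 (Lp.memLp w) e
  by_cases h : G.graph.Adj i j
  · simp only [momentum, if_pos h]
    have h1 := memLp_comp_curve (F := fun _ q => √(extendQuadrant g (q i) (q j) / 2))
      (hg.continuous_mobilityFactor i j) hx ∞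
    exact ((hw (i, j)).sub (hw (j, i))).mul (r := 2) h1
  · simp only [momentum, if_neg h]
    exact MemLp.zero

theorem norm_sq_eq_integral {ι : Type*} [Fintype ι] (w : L2Curve ι) :
    ‖w‖ ^ 2 = ∫ t in Ioo (0 : ℝ) 1, ∑ e, w t e ^ 2 := by
  rw [← real_inner_self_eq_norm_sq, L2.inner_def]
  refine integral_congr_ae (Filter.Eventually.of_forall fun t => ?_)
  simp only [PiLp.inner_apply]
  exact Finset.sum_congr rfl fun e _ => by simp [sq]

/-- A square-integrable function that satisfies the weak continuity equation with boundary values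
is almost everywhere equal to the primitive of its derivative. -/
theorem ae_eq_primitive {y v : ℝ → ℝ} (hy : MemL2 y) (hv : MemL2 v) {y0 y1 : ℝ}
    (h : ∀ φ : ℝ → ℝ, ContDiff ℝ 1 φ → φ 1 * y1 - φ 0 * y0 -
      ∫ t in Ioo (0 : ℝ) 1, deriv φ t * y t = ∫ t in Ioo (0 : ℝ) 1, φ t * v t) :
    (∀ᵐ t ∂volume.restrict (Ioo (0 : ℝ) 1), y t = y0 + ∫ s in (0 : ℝ)..t, v s) ∧
      y1 = y0 + ∫ s in (0 : ℝ)..1, v s := by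
  have h0I : (0 : ℝ) ∈ Icc (0 : ℝ) 1 := ⟨le_rfl, zero_le_one⟩
  have h1I : (1 : ℝ) ∈ Icc (0 : ℝ) 1 := ⟨zero_le_one, le_rfl⟩
  set R : ℝ → ℝ := fun t => y0 + ∫ s in (0 : ℝ)..t, v s with hR
  have hR0 : R 0 = y0 := by simp [hR]
  have hRH : HasH1Deriv R v := hasH1Deriv_of_primitive hv fun t _ => by rw [hR0]
  have hyR : MemL2 fun t => y t - R t := hy.sub hRH.2.1
  have key : ∀ φ : ℝ → ℝ, ContDiff ℝ 1 φ →
      ∫ t in (0 : ℝ)..1, deriv φ t * (y t - R t) = φ 1 * (y1 - R 1) := by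
    intro φ hφ
    have e1 := (hasH1Deriv_of_contDiff hφ).integral_mul_add_mul hRH h0I h1I zero_le_one
    have e2 := h φ hφ
    rw [setIntegral_Ioo_eq_intervalIntegral, setIntegral_Ioo_eq_intervalIntegral] at e2
    have hd : Continuous (deriv φ) := hφ.continuous_deriv le_rfl
    have i1 : IntervalIntegrable (fun t => deriv φ t * R t) volume 0 1 :=
      (hRH.2.1.intervalIntegrable h0I h1I).continuousOn_mul hd.continuousOn
    have i2 : IntervalIntegrable (fun t => φ t * v t) volume 0 1 :=
      (hv.intervalIntegrable h0I h1I).continuousOn_mul hφ.continuous.continuousOn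
    have i3 : IntervalIntegrable (fun t => deriv φ t * y t) volume 0 1 :=
      (hy.intervalIntegrable h0I h1I).continuousOn_mul hd.continuousOn
    rw [intervalIntegral.integral_add i1 i2, hR0] at e1
    simp only [mul_sub]
    rw [intervalIntegral.integral_sub i3 i1]
    linarith
  have hae : ∀ᵐ t, t ∈ Ioo (0 : ℝ) 1 → y t - R t = 0 := by
    refine isOpen_Ioo.ae_eq_zero_of_integral_contDiff_smul_eq_zero
      (IntegrableOn.locallyIntegrableOn (MemLp.integrable one_le_two hyR)) fun ψ hψ _ hψs => ?_
    -- The primitive of `ψ` based at `1` removes the boundary term, so `y - R` is orthogonal to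
    -- every `ψ`. The choice `φ(t) = t` below then yields the endpoint value.
    have hder : ∀ t, HasDerivAt (fun t => ∫ s in (1 : ℝ)..t, ψ s) (ψ t) t := fun t =>
      intervalIntegral.integral_hasDerivAt_right (hψ.continuous.intervalIntegrable _ _)
        hψ.continuous.stronglyMeasurable.stronglyMeasurableAtFilter hψ.continuous.continuousAt
    have hd : deriv (fun t => ∫ s in (1 : ℝ)..t, ψ s) = ψ := funext fun t => (hder t).deriv
    have hφ : ContDiff ℝ 1 fun t => ∫ s in (1 : ℝ)..t, ψ s := by
      rw [contDiff_one_iff_deriv, hd]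
      exact ⟨fun t => (hder t).differentiableAt, hψ.continuous⟩
    have := key _ hφ
    rw [hd, intervalIntegral.integral_same, zero_mul, ← setIntegral_Ioo_eq_intervalIntegral] at this
    rw [← this, setIntegral_eq_integral_of_forall_compl_eq_zero]
    · rfl
    · intro t ht
      rw [eq_zero_of_tsupport_subset_Ioo hψs ht, zero_mul]
  have hae' : ∀ᵐ t ∂volume.restrict (Ioo (0 : ℝ) 1), y t = R t :=
    (ae_restrict_iff' measurableSet_Ioo).2 (hae.mono fun t ht ht' => sub_eq_zero.1 (ht ht'))
  refine ⟨hae', ?_⟩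
  have h1 := key (fun t => t) contDiff_id
  rw [← setIntegral_Ioo_eq_intervalIntegral, integral_congr_ae (g := fun _ => (0 : ℝ))
    (hae'.mono fun t ht => by simp [ht])] at h1
  simp only [integral_zero, one_mul] at h1
  exact sub_eq_zero.1 h1.symm

/-- By continuity the constraints pass from almost every time to all times, endpoints included;
nonnegativity is treated as equality with the positive part. -/
theorem mem_stdSimplex_of_ae {R : ℝ → Fin n → ℝ} (hR : ∀ i, ContinuousOn (fun t => R t i) (Icc 0 1))
    (h : ∀ᵐ t ∂volume.restrict (Ioo (0 : ℝ) 1), R t ∈ stdSimplex ℝ (Fin n)) {t : ℝ}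
    (ht : t ∈ Icc (0 : ℝ) 1) : R t ∈ stdSimplex ℝ (Fin n) := by
  rw [restrict_Ioo_eq_restrict_Icc] at h
  constructor
  · intro i
    have he := Measure.eqOn_Icc_of_ae_eq (μ := volume) zero_ne_one
      (f := fun t => max (R t i) 0) (g := fun t => R t i)
      (h.mono fun t ht => max_eq_left (ht.1 i)) ((hR i).sup continuousOn_const) (hR i) ht
    exact max_eq_left_iff.1 he
  · exact Measure.eqOn_Icc_of_ae_eq (μ := volume) zero_ne_one
      (f := fun t => ∑ i, R t i) (g := fun _ => 1)
      (h.mono fun t ht => ht.2) (continuousOn_finsetSum _ fun i _ => hR i) continuousOn_const ht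

/-- Applied to the least upper bound of the dual values, this gives both the absence of a duality
gap and a minimizer. -/
theorem IsMobility.exists_admissible_action_le (hg : IsMobility g) {ρ0 ρ1 : Fin n → ℝ}
    (hρ1 : ρ1 ∈ stdSimplex ℝ (Fin n)) {D : ℝ} (hD : D ∈ upperBounds (dualValues G g ρ0 ρ1)) :
    ∃ p ∈ admissible G ρ0 ρ1, action G g p.1 p.2 ≤ ENNReal.ofReal D := by
  obtain ⟨x, hx, hopt⟩ := hg.exists_optimal_curve hρ1 hD
  obtain ⟨w, hw, hwD⟩ := exists_inner_eq_of_le_quadratic (weightedGradMap G hg hx)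
    (defect ρ0 ρ1 hx) (D := D) fun l => by
      have h := hopt l l.2
      have hn : Integrable (fun t => normSq G (extendQuadrant g) (x t).ofLp (grad G (l.1 t)))
          (volume.restrict (Ioo (0 : ℝ) 1)) := by
        have hc : Continuous fun p : ℝ × (Fin n → ℝ) => (p.2, grad G (l.1 p.1)) :=
          continuous_snd.prodMk
            (continuous_grad.comp ((continuous_of_mem_c1Curves l.2).comp continuous_fst))
        exact integrable_comp_curve
          (F := fun t q => normSq G (extendQuadrant g) q (grad G (l.1 t)))
          ((hg.continuous_normSq (G := G)).comp hc) hx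
      have hv := integrable_comp_curve
        (F := fun t q => ∑ i, velocity l.1 t i * q i) (continuous_sum_velocity_mul l.2) hx
      simp only [lagrangian] at h
      rw [integral_add hv (hn.const_mul _), integral_const_mul] at h
      rw [defect_apply, norm_sq_weightedGradMap]
      linarith
  set m : ℝ → Matrix (Fin n) (Fin n) ℝ := fun t => momentum G g (x t).ofLp (w t).ofLp with hm
  have hmL : ∀ i j, MemL2 fun t => m t i j := hg.memL2_momentum hx w
  have hdiv : ∀ i, MemL2 fun t => -divergence G (m t) i := fun i =>
    MemLp.neg (memLp_finsetSum _ fun j _ => (hmL j i).const_mul _)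
  set R : ℝ → Fin n → ℝ := fun t i => ρ0 i + ∫ s in (0 : ℝ)..t, -divergence G (m s) i with hR
  have hR0 : R 0 = ρ0 := by ext i; simp [hR]
  have hweak : ∀ i, (∀ᵐ t ∂volume.restrict (Ioo (0 : ℝ) 1), (x t).ofLp i = R t i) ∧
      ρ1 i = R 1 i := by
    intro i
    refine ae_eq_primitive (memLp_piLp_iff.1 (Lp.memLp x) i) (hdiv i) fun φ hφ => ?_
    -- A test curve supported on a single vertex isolates one component of the continuity equation.
    have hl : (fun t => Pi.single i (φ t) : ℝ → Fin n → ℝ) ∈ c1Curves n := by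
      intro j
      by_cases hj : j = i
      · subst hj; simpa using hφ
      · simpa [hj] using contDiff_const
    have h := hw ⟨_, hl⟩
    rw [inner_weightedGradMap, defect_apply] at h
    have hvel : ∀ t, velocity (fun t => Pi.single i (φ t) : ℝ → Fin n → ℝ) t =
        Pi.single i (deriv φ t) := by
      intro t
      ext j
      by_cases hj : j = i
      · subst hj; simp [velocity]
      · simp [velocity, hj]
    simp only [← hg.sum_mul_divergence_momentum, hvel, boundaryTerm, Pi.single_apply, ite_mul,
      zero_mul, Finset.sum_ite_eq', Finset.mem_univ, if_true] at h
    exact h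
  have hRH : ∀ i, HasH1Deriv (fun t => R t i) fun t => -divergence G (m t) i := fun i =>
    hasH1Deriv_of_primitive (hdiv i) fun t _ => by
      rw [show R 0 i = ρ0 i from congrFun hR0 i]
  have hRx : ∀ᵐ t ∂volume.restrict (Ioo (0 : ℝ) 1), (x t).ofLp = R t := by
    filter_upwards [ae_all_iff.2 fun i => (hweak i).1] with t ht
    exact funext ht
  have hRs : ∀ᵐ t ∂volume.restrict (Ioo (0 : ℝ) 1), R t ∈ stdSimplex ℝ (Fin n) := by
    filter_upwards [hRx, hx] with t h1 h2
    rwa [← h1]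
  refine ⟨(R, m), ⟨fun t ht => mem_stdSimplex_of_ae (fun i => (hRH i).1) hRs ht,
    fun i => ⟨_, hRH i⟩,
    Filter.Eventually.of_forall fun t => hg.momentum_transpose _ _, fun i j _ => hmL i j, hR0,
    funext fun i => (hweak i).2.symm, fun i => (hRH i).2.2.2⟩, ?_⟩
  have hwi : Integrable (fun t => ∑ e, (w t).ofLp e ^ 2) (volume.restrict (Ioo (0 : ℝ) 1)) :=
    integrable_finsetSum _ fun e _ => (memLp_piLp_iff.1 (Lp.memLp w) e).integrable_sq
  have hle : ∫⁻ t in Ioo (0 : ℝ) 1, kineticEnergy G g (R t) (m t) ≤ ENNReal.ofReal (‖w‖ ^ 2) := by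
    rw [norm_sq_eq_integral, ofReal_integral_eq_lintegral_ofReal hwi
      (Filter.Eventually.of_forall fun t => Finset.sum_nonneg fun _ _ => sq_nonneg _)]
    refine lintegral_mono_ae ?_
    filter_upwards [hRx, hx] with t h1 h2
    rw [← h1]
    exact hg.kineticEnergy_momentum_le h2.1 _
  calc action G g R m ≤ 1 / 2 * ENNReal.ofReal (‖w‖ ^ 2) := by rw [action]; gcongr
    _ = ENNReal.ofReal (1 / 2 * ‖w‖ ^ 2) := by
      rw [ENNReal.ofReal_mul (by norm_num), ENNReal.ofReal_div_of_pos two_pos, ENNReal.ofReal_one,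
        ENNReal.ofReal_ofNat]
    _ ≤ ENNReal.ofReal D := ENNReal.ofReal_le_ofReal hwD

/-- The zero curve shows that the dual problem is nonempty and its supremum nonnegative, so the
value passes unchanged through `ENNReal.ofReal`. -/
theorem IsMobility.zero_mem_dualValues (hg : IsMobility g) (ρ0 : Fin n → ℝ) {ρ1 : Fin n → ℝ}
    (hρ1 : ρ1 ∈ stdSimplex ℝ (Fin n)) : (0 : ℝ) ∈ dualValues G g ρ0 ρ1 := by
  have h := hg.boundaryTerm_sub_integral_mem_dualValues (G := G) (ρ0 := ρ0) hρ1
    (c1Curves n).zero_mem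
  have hv : ∀ t, velocity (0 : ℝ → Fin n → ℝ) t = 0 := fun t => by ext i; simp [velocity]
  have hgr : grad G 0 = 0 := by ext i j; simp [grad]
  have hH : hamiltonian G g 0 0 = 0 := by
    simp [hamiltonian, normSq, G.nonempty_stdSimplex.image_const]
  simpa [boundaryTerm, hv, hgr, hH] using h

end Recovery

end GraphTransport

/-! ### The duality theorem. -/

theorem mainTheorem2 {n : ℕ} (G : GraphTransport.WeightedGraph n) (g : ℝ → ℝ → ℝ)
    (hg : GraphTransport.IsMobility g) (hCg : GraphTransport.energyConstant g < ⊤)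
    (ρ0 ρ1 : Fin n → ℝ) (hρ0 : ρ0 ∈ stdSimplex ℝ (Fin n)) (hρ1 : ρ1 ∈ stdSimplex ℝ (Fin n)) :
    ∃ c : ℝ,
      IsLeast ((fun p => (GraphTransport.action G g p.1 p.2 : EReal)) ''
        GraphTransport.admissible G ρ0 ρ1) (c : EReal) ∧
      IsLUB (GraphTransport.dualValues G g ρ0 ρ1) c := by
  have h0 := hg.zero_mem_dualValues (G := G) ρ0 hρ1
  have hlub := isLUB_csSup ⟨0, h0⟩ (GraphTransport.bddAbove_dualValues (G := G) hg hρ0 hρ1)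
  set c := sSup (GraphTransport.dualValues G g ρ0 ρ1)
  have hc : 0 ≤ c := hlub.1 h0
  have hcoe : (c : EReal) = ((ENNReal.ofReal c : ENNReal) : EReal) := by
    rw [EReal.coe_ennreal_ofReal, max_eq_left hc]
  have hlow : ∀ p ∈ GraphTransport.admissible G ρ0 ρ1,
      ENNReal.ofReal c ≤ GraphTransport.action G g p.1 p.2 := by
    intro p hp
    by_cases htop : GraphTransport.action G g p.1 p.2 = ⊤
    · rw [htop]
      exact le_top
    · exact ENNReal.ofReal_le_of_le_toReal (hlub.2 fun x hx =>
        (ENNReal.ofReal_le_iff_le_toReal htop).1 (GraphTransport.dualValue_le_action hg hp hx))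
  obtain ⟨p, hp, hle⟩ := hg.exists_admissible_action_le hρ1 hlub.1
  refine ⟨c, ⟨⟨p, hp, ?_⟩, ?_⟩, hlub⟩
  · rw [hcoe]
    exact congrArg _ (le_antisymm hle (hlow p hp))
  · rintro _ ⟨q, hq, rfl⟩
    rw [hcoe]
    exact EReal.coe_ennreal_le_coe_ennreal_iff.2 (hlow q hq)
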